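/- Let $k\in\mathbb{C}$ and let $\Pi\subset\mathbb{R}^2$ be an unbounded open set such that, for all sufficiently large $R>0$, the truncation $\Pi_R:=\{x\in\Pi:\ |x|<R+1\}$ is a Lipschitz domain, i.e. a bounded open set (not necessarily connected) that near each of its boundary points coincides, in suitable orthonormal coordinates, with the set of points lying strictly above the graph of a Lipschitz function. Let $v\in L^2(\Pi)$ be a complex-valued function such that $v|_B\in H^1(B)$ for every bounded open subset $B\subset\Pi$. Suppose that $\Delta v+k^2v=0$ in $\Pi$ in the sense of distributions, and that the trace of $v$ is zero on $\partial\Pi$, i.e. for all sufficiently large $R$ the trace in $L^2(\partial\Pi_R)$ of $v|_{\Pi_R}\in H^1(\Pi_R)$ vanishes almost everywhere, with respect to arc length, on $\partial\Pi\cap\{|x|<R+1\}$. (The trace operator $H^1(\Pi_R)\to L^2(\partial\Pi_R)$ is the continuous extension of the map $\varphi\mapsto\varphi|_{\partial\Pi_R}$ from restrictions to $\Pi_R$ of functions $\varphi\in C^\infty(\mathbb{R}^2)$.) Then $v\in H^1(\Pi)$. -/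

import Mathlib

open MeasureTheory Filter Topology Set
open scoped ENNReal ContDiff InnerProductSpace

namespace Helmholtz

/-- The Euclidean plane `ℝ²`. -/
abbrev Plane : Type := EuclideanSpace ℝ (Fin 2)

/-- The partial derivative `∂ᵢ f` of a differentiable function on the plane. -/
noncomputable def partialDeriv {F : Type*} [NormedAddCommGroup F] [NormedSpace ℝ F]
    (i : Fin 2) (f : Plane → F) (x : Plane) : F :=
  fderiv ℝ f x (EuclideanSpace.single i (1 : ℝ))

/-- `φ` is a (real-valued) test function on the open set `D`, i.e. `φ ∈ C_c^∞(D)`. -/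
structure IsTestFunction (D : Set Plane) (φ : Plane → ℝ) : Prop where
  contDiff : ContDiff ℝ ∞ φ
  hasCompactSupport : HasCompactSupport φ
  tsupport_subset : tsupport φ ⊆ D

/-- `u ∈ H¹(D)` with weak gradient `G = (G 0, G 1) ∈ L²(D)²`:
`∫_D u ∂ᵢφ = -∫_D (G i) φ` for all test functions `φ` on `D` and both `i`. -/
structure IsH1WithGradient (D : Set Plane) (u : Plane → ℂ) (G : Fin 2 → Plane → ℂ) : Prop where
  memLp : MemLp u 2 (volume.restrict D)
  memLp_gradient : ∀ i, MemLp (G i) 2 (volume.restrict D)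
  integral_eq : ∀ (i : Fin 2) (φ : Plane → ℝ), IsTestFunction D φ →
    ∫ x in D, u x * ((partialDeriv i φ x : ℝ) : ℂ) = -∫ x in D, G i x * (φ x : ℂ)

/-- Membership in the Sobolev space `H¹(D)` of complex-valued functions on the open set `D`
(only the values of `u` on `D` matter). -/
def MemH1 (D : Set Plane) (u : Plane → ℂ) : Prop :=
  ∃ G : Fin 2 → Plane → ℂ, IsH1WithGradient D u G

/-- `Δ v + k² v = 0` in the open set `D`, in the sense of distributions. -/
def SolvesHelmholtz (k : ℂ) (D : Set Plane) (v : Plane → ℂ) : Prop :=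
  ∀ φ : Plane → ℝ, IsTestFunction D φ →
    ∫ x in D, v x * (((Laplacian.laplacian φ x : ℝ) : ℂ) + k ^ 2 * (φ x : ℂ)) = 0

/-- A bounded Lipschitz domain: a bounded open set which, near each of its boundary points, is the
strict epigraph of a Lipschitz function in suitable orthonormal coordinates `e`. (The position of
the origin does not matter, since a translation can be absorbed in `ζ`. Connectedness is not
required.) -/
structure IsLipschitzDomain (D : Set Plane) : Prop where
  isOpen : IsOpen D
  isBounded : Bornology.IsBounded D
  exists_graph : ∀ x ∈ frontier D,
    ∃ (e : Plane ≃ₗᵢ[ℝ] Plane) (ζ : ℝ → ℝ), (∃ K, LipschitzWith K ζ) ∧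
      ∃ r > 0, ∀ y ∈ Metric.ball x r, (y ∈ D ↔ ζ (e y 0) < e y 1)

/-- The function `g` on `∂D` is the trace of `u ∈ H¹(D)`, for a bounded Lipschitz domain `D`. The
trace operator is the continuous extension to `H¹(D)`, with values in `L²(∂D)`, of the restriction
map `φ ↦ φ|_∂D` defined on the dense space of the functions `φ` that are smooth up to the boundary;
so `g` is the trace of `u` iff some sequence of such functions converges to `u` in `H¹(D)` while
its restrictions to `∂D` converge to `g` in `L²(∂D)`. The measure on `∂D` is arc length. -/
def HasTrace (D : Set Plane) (u g : Plane → ℂ) : Prop :=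
  MemLp g 2 ((μH[1] : Measure Plane).restrict (frontier D)) ∧
  ∃ G : Fin 2 → Plane → ℂ, IsH1WithGradient D u G ∧
  ∃ φ : ℕ → Plane → ℂ, (∀ n, ContDiff ℝ ∞ (φ n)) ∧
    Tendsto (fun n => eLpNorm (φ n - u) 2 (volume.restrict D)) atTop (𝓝 0) ∧
    (∀ i, Tendsto (fun n => eLpNorm (partialDeriv i (φ n) - G i) 2 (volume.restrict D))
      atTop (𝓝 0)) ∧
    Tendsto (fun n => eLpNorm (φ n - g) 2 ((μH[1] : Measure Plane).restrict (frontier D)))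
      atTop (𝓝 0)

/-- The truncation `Π_R = {x ∈ Π : |x| < R + 1}`. -/
def truncation (P : Set Plane) (R : ℝ) : Set Plane :=
  {x ∈ P | ‖x‖ < R + 1}

/-- The trace of `v` is zero on `∂Π`, where `v` is `H¹` on bounded open subsets of `Π` and the
truncations of `Π` are Lipschitz domains for large `R`: for all large `R`, the trace of
`v|_{Π_R}` on `∂Π_R` vanishes almost everywhere (for arc length) on the part of `∂Π` inside the
disk `|x| < R + 1`. -/
def HasZeroTrace (P : Set Plane) (v : Plane → ℂ) : Prop :=
  ∀ᶠ R : ℝ in atTop, ∃ g : Plane → ℂ, HasTrace (truncation P R) v g ∧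
    ∀ᵐ x ∂((μH[1] : Measure Plane).restrict (frontier P ∩ {x | ‖x‖ < R + 1})), g x = 0

end Helmholtz

/-! Formally, multiply the equation by `χ² v̄`, with `χ` a cutoff equal to 1 on a disk of radius
`ρ`. The boundary term vanishes because the trace does, so `∫ χ²|∇v|² = Re(k² ∫ χ²|v|²) - 2 Re ∫ χ
v̄ ∇χ·∇v`. Absorbing the cross term by Young's inequality gives the Caccioppoli bound
`sum_integral_sq_mul_gradient_le`. Its constant does not depend on `ρ` once `∇χ` is uniformly
bounded (`exists_cutoff`), and `v` is globally square integrable, so the gradients on growing disks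
are uniformly bounded in `L²` and glue to a global one (`memH1_iUnion`).

The work lies in admitting `χ² v̄` as a test function, since the equation is only given against
smooth functions compactly supported in the open set. For a cutoff `η`, Green's identity is the
vanishing of `energyDefect`. It is linear in `η`, so a partition of unity localizes it
(`energyDefect_eq_zero_of_local`). Near a boundary point, the divergence theorem over a Lipschitz
epigraph and the zero trace give integration by parts without boundary term
(`setIntegral_mul_partialDeriv_of_zero_trace`). Hence `η v` extended by zero has a weak gradient in
the whole plane. Translations into the cone above the graph push its support into the domain, where
mollification yields admissible test functions; continuity of translation in `L²` brings the
identity back to the untranslated function (`sum_integral_mul_eq_of_translate`). -/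

namespace Helmholtz

/-! ### Divergence theorem over the epigraph of a Lipschitz function. -/

section Graph

variable {f : ℝ × ℝ → ℝ} {ζ : ℝ → ℝ} {K : NNReal}

theorem integral_deriv_eq_zero_of_lipschitzWith {h : ℝ → ℝ} {C : NNReal} (hh : LipschitzWith C h)
    (hc : HasCompactSupport h) : ∫ t, deriv h t = 0 := by
  -- Integration by parts against the constant 1 reverses the direction, so `-1` produces the
  -- derivative of `h` in direction `+1`.
  have := (LipschitzWith.const (1 : ℝ) (α := ℝ)).integral_lineDeriv_mul_eq (μ := volume) hh hc (-1)
  simpa [lineDeriv, deriv_comp_const_add] using this.symm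

theorem integrable_fderiv_apply (hf : ContDiff ℝ 1 f) (hc : HasCompactSupport f) (d : ℝ × ℝ) :
    Integrable (fun p => fderiv ℝ f p d) := by
  refine Continuous.integrable_of_hasCompactSupport ?_ ?_
  · exact (hf.continuous_fderiv one_ne_zero).clm_apply continuous_const
  · exact hc.fderiv_apply (𝕜 := ℝ) d

theorem measurableSet_epigraph (hζ : Continuous ζ) : MeasurableSet {p : ℝ × ℝ | ζ p.1 < p.2} :=
  measurableSet_lt (hζ.measurable.comp measurable_fst) measurable_snd

theorem integral_epigraph_eq {F : ℝ × ℝ → ℝ} (hζ : Continuous ζ)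
    (hF : IntegrableOn F {p : ℝ × ℝ | ζ p.1 < p.2}) :
    ∫ p in {p : ℝ × ℝ | ζ p.1 < p.2}, F p = ∫ t, ∫ s in Ioi (ζ t), F (t, s) := by
  rw [← integral_indicator (measurableSet_epigraph hζ), Measure.volume_eq_prod, integral_prod]
  · refine integral_congr_ae (.of_forall fun t => ?_)
    simp only
    rw [← integral_indicator measurableSet_Ioi]
    refine integral_congr_ae (.of_forall fun s => ?_)
    simp [indicator]
  · rw [← Measure.volume_eq_prod]
    exact (integrable_indicator_iff (measurableSet_epigraph hζ)).2 hF

theorem integral_Ioi_fderiv_vertical (hf : ContDiff ℝ 1 f) (hc : HasCompactSupport f) (t a : ℝ) :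
    ∫ s in Ioi a, fderiv ℝ f (t, s) (0, 1) = -f (t, a) := by
  have hemb : IsClosedEmbedding (fun s : ℝ => (t, s)) := 
    Function.LeftInverse.isClosedEmbedding (f := Prod.snd) (fun _ => rfl) continuous_snd
      (Continuous.prodMk_right t)
  have hd : ∀ s, HasDerivAt (fun s => f (t, s)) (fderiv ℝ f (t, s) (0, 1)) s := fun s =>
    ((hf.differentiable one_ne_zero) (t, s)).hasFDerivAt.comp_hasDerivAt s
      ((hasDerivAt_const s t).prodMk (hasDerivAt_id s))
  have hc' : HasCompactSupport (fun s => f (t, s)) := hc.comp_isClosedEmbedding hemb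
  rw [integral_Ioi_of_hasDerivAt_of_tendsto (m := 0)
    (hd a).continuousAt.continuousWithinAt (fun s _ => hd s)]
  · simp
  · refine (Continuous.integrable_of_hasCompactSupport ?_ ?_).integrableOn
    · exact ((hf.continuous_fderiv one_ne_zero).clm_apply continuous_const).comp
        (Continuous.prodMk_right t)
    · exact (hc.fderiv_apply (𝕜 := ℝ) (0, 1)).comp_isClosedEmbedding hemb
  · exact (hc'.is_zero_at_infty).mono_left atTop_le_cocompact

theorem integral_epigraph_fderiv_vertical (hf : ContDiff ℝ 1 f) (hc : HasCompactSupport f)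
    (hζ : Continuous ζ) :
    ∫ p in {p : ℝ × ℝ | ζ p.1 < p.2}, fderiv ℝ f p (0, 1) = -∫ t, f (t, ζ t) := by
  rw [integral_epigraph_eq hζ (integrable_fderiv_apply hf hc _).integrableOn, ← integral_neg]
  exact integral_congr_ae (.of_forall fun t => integral_Ioi_fderiv_vertical hf hc t _)

/-- The shear `(t, s) ↦ (t, ζ t + s)` preserves the area. -/
theorem measurePreserving_shear (hζ : Continuous ζ) :
    MeasurePreserving (fun p : ℝ × ℝ => (p.1, ζ p.1 + p.2)) := by
  rw [Measure.volume_eq_prod]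
  refine (MeasurePreserving.id volume).skew_product (g := fun t s => ζ t + s) ?_ ?_
  · fun_prop
  · exact .of_forall fun t => (measurePreserving_add_left volume (ζ t)).map_eq

theorem integral_epigraph_eq_swap {F : ℝ × ℝ → ℝ} (hζ : Continuous ζ) (hF : Integrable F) :
    ∫ p in {p : ℝ × ℝ | ζ p.1 < p.2}, F p = ∫ s in Ioi (0 : ℝ), ∫ t, F (t, ζ t + s) := by
  have hm := measurePreserving_shear hζ
  have hI : Integrable (({p : ℝ × ℝ | ζ p.1 < p.2}).indicator F) :=
    hF.indicator (measurableSet_epigraph hζ)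
  have hJ := hm.integrable_comp_of_integrable hI
  rw [← integral_indicator (measurableSet_epigraph hζ)]
  have h1 : ∫ p, ({p : ℝ × ℝ | ζ p.1 < p.2}).indicator F p =
      ∫ p : ℝ × ℝ, ({p : ℝ × ℝ | ζ p.1 < p.2}).indicator F (p.1, ζ p.1 + p.2) := by
    conv_lhs => rw [← hm.map_eq]
    refine integral_map hm.measurable.aemeasurable ?_
    rw [hm.map_eq]
    exact hI.aestronglyMeasurable
  rw [h1, Measure.volume_eq_prod, integral_prod_symm]
  · rw [← integral_indicator measurableSet_Ioi]
    refine integral_congr_ae (.of_forall fun s => ?_)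
    by_cases hs : 0 < s <;> simp [indicator, hs]
  · rwa [← Measure.volume_eq_prod]

/-- Slice the epigraph by vertical translates of the graph. Along each slice the total derivative of
`f` integrates to zero, which trades the horizontal derivative for `-ζ'` times the vertical one.
Only a.e. differentiability of `ζ` enters. -/
theorem integral_epigraph_fderiv_horizontal (hf : ContDiff ℝ 1 f) (hc : HasCompactSupport f)
    (hζ : LipschitzWith K ζ) :
    ∫ p in {p : ℝ × ℝ | ζ p.1 < p.2}, fderiv ℝ f p (1, 0) = ∫ t, deriv ζ t * f (t, ζ t) := by
  have hcζ := hζ.continuous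
  obtain ⟨C, hC⟩ := hf.lipschitzWith_of_hasCompactSupport hc one_ne_zero
  have hint := integrable_fderiv_apply hf hc (0, 1)
  have hint' : Integrable (fun p : ℝ × ℝ => deriv ζ p.1 * fderiv ℝ f p (0, 1)) := by
    refine hint.bdd_mul (c := K) ?_ (.of_forall fun p => norm_deriv_le_of_lipschitz hζ)
    exact ((measurable_deriv ζ).comp measurable_fst).aestronglyMeasurable
  have key : ∀ s, ∫ t, fderiv ℝ f (t, ζ t + s) (1, 0) =
      -∫ t, deriv ζ t * fderiv ℝ f (t, ζ t + s) (0, 1) := by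
    intro s
    have hlip : LipschitzWith (max 1 K) (fun t => (t, ζ t + s)) :=
      LipschitzWith.id.prodMk (by simpa using hζ.add (LipschitzWith.const s))
    have hemb : IsClosedEmbedding (fun t => (t, ζ t + s)) :=
      Function.LeftInverse.isClosedEmbedding (f := Prod.fst) (fun t => rfl) continuous_fst
        hlip.continuous
    have hc' : HasCompactSupport (fun t => f (t, ζ t + s)) := hc.comp_isClosedEmbedding hemb
    have h0 := integral_deriv_eq_zero_of_lipschitzWith (hC.comp hlip) hc'
    have hI : ∀ d, Integrable (fun t => fderiv ℝ f (t, ζ t + s) d) := fun d =>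
      Continuous.integrable_of_hasCompactSupport
        (((hf.continuous_fderiv one_ne_zero).clm_apply continuous_const).comp hlip.continuous)
        ((hc.fderiv_apply (𝕜 := ℝ) d).comp_isClosedEmbedding hemb)
    have h1 : ∫ t, deriv (f ∘ fun t => (t, ζ t + s)) t =
        ∫ t, (fderiv ℝ f (t, ζ t + s) (1, 0) + deriv ζ t * fderiv ℝ f (t, ζ t + s) (0, 1)) := by
      refine integral_congr_ae ?_
      filter_upwards [hζ.ae_differentiableAt] with t ht
      have hd := ((hf.differentiable one_ne_zero) (t, ζ t + s)).hasFDerivAt.comp_hasDerivAt t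
        ((hasDerivAt_id t).prodMk (ht.hasDerivAt.add_const s))
      refine hd.deriv.trans ?_
      have : ((1 : ℝ), deriv ζ t) = (1, 0) + deriv ζ t • ((0 : ℝ), (1 : ℝ)) := by simp
      rw [this, map_add, map_smul, smul_eq_mul]
    rw [h0, integral_add (hI _)] at h1
    · linarith
    · exact (hI _).bdd_mul (c := K) (measurable_deriv ζ).aestronglyMeasurable
        (.of_forall fun p => norm_deriv_le_of_lipschitz hζ)
  rw [integral_epigraph_eq_swap hcζ (integrable_fderiv_apply hf hc _)]
  simp_rw [key]
  rw [integral_neg, ← integral_epigraph_eq_swap (F := fun p => deriv ζ p.1 * fderiv ℝ f p (0, 1))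
    hcζ hint', integral_epigraph_eq hcζ hint'.integrableOn, ← integral_neg]
  refine integral_congr_ae (.of_forall fun t => ?_)
  simp only
  rw [integral_const_mul, integral_Ioi_fderiv_vertical hf hc]
  ring

theorem abs_integral_epigraph_fderiv_le (hf : ContDiff ℝ 1 f) (hc : HasCompactSupport f)
    (hζ : LipschitzWith K ζ) (d : ℝ × ℝ) :
    |∫ p in {p : ℝ × ℝ | ζ p.1 < p.2}, fderiv ℝ f p d| ≤
      (|d.1| * K + |d.2|) * ∫ t, |f (t, ζ t)| := by
  have hd : ∀ p, fderiv ℝ f p d = d.1 * fderiv ℝ f p (1, 0) + d.2 * fderiv ℝ f p (0, 1) := by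
    intro p
    have : d = d.1 • ((1 : ℝ), (0 : ℝ)) + d.2 • ((0 : ℝ), (1 : ℝ)) := by ext <;> simp
    conv_lhs => rw [this, map_add, map_smul, map_smul]
    rfl
  have hI := fun d => (integrable_fderiv_apply hf hc d).integrableOn
    (s := {p : ℝ × ℝ | ζ p.1 < p.2})
  have hint : Integrable (fun t => f (t, ζ t)) :=
    Continuous.integrable_of_hasCompactSupport
      (hf.continuous.comp (continuous_id.prodMk hζ.continuous))
      (hc.comp_isClosedEmbedding (Function.LeftInverse.isClosedEmbedding (f := Prod.fst)
        (fun t => rfl) continuous_fst (continuous_id.prodMk hζ.continuous)))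
  simp_rw [hd]
  rw [integral_add ((hI _).const_mul _) ((hI _).const_mul _), integral_const_mul,
    integral_const_mul, integral_epigraph_fderiv_horizontal hf hc hζ,
    integral_epigraph_fderiv_vertical hf hc hζ.continuous]
  have h1 : |∫ t, deriv ζ t * f (t, ζ t)| ≤ K * ∫ t, |f (t, ζ t)| := by
    rw [← integral_const_mul]
    refine (abs_integral_le_integral_abs).trans (integral_mono_of_nonneg
      (.of_forall fun t => abs_nonneg _) (hint.abs.const_mul _) (.of_forall fun t => ?_))
    simp only [abs_mul]
    exact mul_le_mul_of_nonneg_right (norm_deriv_le_of_lipschitz hζ) (abs_nonneg _)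
  have h2 : |∫ t, f (t, ζ t)| ≤ ∫ t, |f (t, ζ t)| := abs_integral_le_integral_abs
  calc _ ≤ |d.1| * |∫ t, deriv ζ t * f (t, ζ t)| + |d.2| * |∫ t, f (t, ζ t)| := by
        refine (abs_add_le _ _).trans ?_
        rw [abs_mul, abs_mul, abs_neg]
    _ ≤ |d.1| * (K * ∫ t, |f (t, ζ t)|) + |d.2| * ∫ t, |f (t, ζ t)| := by gcongr
    _ = _ := by ring

end Graph

/-! ### Passage to the limit in `L²` pairings. -/

section L2

variable {α : Type*} {m : MeasurableSpace α} {μ : Measure α}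

theorem tendsto_integral_mul_of_tendsto_eLpNorm {a : ℕ → α → ℂ} {a₀ b : α → ℂ}
    (ha : ∀ n, AEStronglyMeasurable (a n) μ) (ha₀ : MemLp a₀ 2 μ) (hb : MemLp b 2 μ)
    (h : Tendsto (fun n => eLpNorm (a n - a₀) 2 μ) atTop (𝓝 0)) :
    Tendsto (fun n => ∫ x, a n x * b x ∂μ) atTop (𝓝 (∫ x, a₀ x * b x ∂μ)) := by
  have hfin : ∀ᶠ n in atTop, MemLp (a n) 2 μ := by
    filter_upwards [h.eventually (gt_mem_nhds ENNReal.zero_lt_top)] with n hn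
    have : MemLp (a n - a₀) 2 μ := ⟨(ha n).sub ha₀.1, hn⟩
    simpa using this.add ha₀
  refine tendsto_integral_of_L1' _ (ha₀.integrable_mul hb).1
    (hfin.mono fun n hn => hn.integrable_mul hb) ?_
  have hz : Tendsto (fun n => eLpNorm (a n - a₀) 2 μ * eLpNorm b 2 μ) atTop (𝓝 0) := by
    simpa using ENNReal.Tendsto.mul_const h (.inr hb.2.ne)
  refine tendsto_of_tendsto_of_tendsto_of_le_of_le tendsto_const_nhds hz
    (fun n => bot_le) fun n => ?_
  have := eLpNorm_smul_le_mul_eLpNorm (p := 2) (q := 2) (r := 1) hb.1 ((ha n).sub ha₀.1)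
  refine le_trans (le_of_eq ?_) this
  congr 1
  ext x
  simp [sub_mul]

end L2

/-! ### Transfer to orthonormal coordinates and comparison with arc length. -/

section Chart

variable (e : Plane ≃ₗᵢ[ℝ] Plane) (ζ : ℝ → ℝ)

/-- The coordinates `p` with respect to the orthonormal coordinate system `e`, as a point of the
plane. -/
noncomputable def chart : (ℝ × ℝ) ≃L[ℝ] Plane :=
  ((ContinuousLinearEquiv.finTwoArrow ℝ ℝ).symm.trans
    (PiLp.continuousLinearEquiv 2 ℝ (fun _ : Fin 2 => ℝ)).symm).trans
    e.symm.toContinuousLinearEquiv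

@[simp] theorem apply_chart_zero (p : ℝ × ℝ) : e (chart e p) 0 = p.1 := by simp [chart]

@[simp] theorem apply_chart_one (p : ℝ × ℝ) : e (chart e p) 1 = p.2 := by simp [chart]

theorem chart_symm_apply (x : Plane) : (chart e).symm x = (e x 0, e x 1) := by
  rw [ContinuousLinearEquiv.symm_apply_eq]
  apply e.injective
  ext i
  fin_cases i <;> simp

theorem measurePreserving_chart : MeasurePreserving (chart e) := by
  have h1 : MeasurePreserving (MeasurableEquiv.finTwoArrow (α := ℝ)).symm :=
    (volume_preserving_finTwoArrow ℝ).symm _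
  have h2 := PiLp.volume_preserving_toLp (Fin 2)
  have h3 := e.symm.measurePreserving
  exact (h3.comp (h2.comp h1))

/-- The parametrization of the graph of `ζ` in the orthonormal coordinate system `e`. -/
noncomputable def graphCurve (t : ℝ) : Plane := chart e (t, ζ t)

variable {e ζ} {D : Set Plane} {x₀ : Plane} {r : ℝ} {K : NNReal}

theorem continuous_graphCurve (hζ : Continuous ζ) : Continuous (graphCurve e ζ) :=
  (chart e).continuous.comp (continuous_id.prodMk hζ)

theorem graphCurve_mem_frontier (hD : IsOpen D)
    (hgraph : ∀ y ∈ Metric.ball x₀ r, (y ∈ D ↔ ζ (e y 0) < e y 1)) {t : ℝ}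
    (ht : graphCurve e ζ t ∈ Metric.ball x₀ r) : graphCurve e ζ t ∈ frontier D := by
  rw [hD.frontier_eq]
  refine ⟨?_, fun h => ?_⟩
  · have hc : Continuous (fun s : ℝ => chart e (t, ζ t + s)) :=
      (chart e).continuous.comp (by fun_prop)
    have hlim : Tendsto (fun s : ℝ => chart e (t, ζ t + s)) (𝓝[>] 0) (𝓝 (graphCurve e ζ t)) := by
      have := hc.tendsto 0
      simp only [add_zero] at this
      exact this.mono_left nhdsWithin_le_nhds
    refine mem_closure_of_tendsto hlim ?_
    filter_upwards [hlim.eventually (Metric.isOpen_ball.mem_nhds ht), self_mem_nhdsWithin] with s hs h0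
    rw [hgraph _ hs]
    simpa using h0
  · rw [hgraph _ ht] at h
    simp [graphCurve] at h

/-- The projection to the first coordinate is 1-Lipschitz and inverts the parametrization, so
Lebesgue measure in the parameter is at most arc length. This one-sided comparison makes the arc
length formula unnecessary. -/
theorem map_graphCurve_le (hD : IsOpen D) (hζ : Continuous ζ)
    (hgraph : ∀ y ∈ Metric.ball x₀ r, (y ∈ D ↔ ζ (e y 0) < e y 1)) :
    (volume.restrict (graphCurve e ζ ⁻¹' Metric.ball x₀ r)).map (graphCurve e ζ) ≤
      (μH[1] : Measure Plane).restrict (frontier D ∩ Metric.ball x₀ r) := by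
  have hc := continuous_graphCurve (e := e) hζ
  have hlip : LipschitzWith 1 (fun x : Plane => e x 0) := by
    refine LipschitzWith.of_dist_le_mul fun x y => ?_
    rw [NNReal.coe_one, one_mul, ← e.dist_map x y, Real.dist_eq, dist_eq_norm,
      ← PiLp.sub_apply, ← Real.norm_eq_abs]
    exact PiLp.norm_apply_le _ _
  refine Measure.le_iff.2 fun A hA => ?_
  rw [Measure.map_apply hc.measurable hA, Measure.restrict_apply (hc.measurable hA),
    Measure.restrict_apply hA, ← hausdorffMeasure_real]
  calc _ ≤ μH[1] ((fun x : Plane => e x 0) '' (A ∩ (frontier D ∩ Metric.ball x₀ r))) := by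
        refine measure_mono fun t ht => ⟨graphCurve e ζ t, ⟨ht.1, ?_, ht.2⟩, ?_⟩
        · exact graphCurve_mem_frontier hD hgraph ht.2
        · simp [graphCurve]
    _ ≤ _ := by
        simpa using hlip.hausdorffMeasure_image_le zero_le_one (A ∩ (frontier D ∩ Metric.ball x₀ r))

theorem abs_setIntegral_fderiv_le {f : Plane → ℝ} (hf : ContDiff ℝ 1 f) (hc : HasCompactSupport f)
    (hsupp : tsupport f ⊆ Metric.ball x₀ r) (hD : IsOpen D) (hζ : LipschitzWith K ζ)
    (hgraph : ∀ y ∈ Metric.ball x₀ r, (y ∈ D ↔ ζ (e y 0) < e y 1)) (u : Plane) :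
    |∫ x in D, fderiv ℝ f x u| ≤
      (|e u 0| * K + |e u 1|) * ∫ t, |f (graphCurve e ζ t)| := by
  have hf' : ContDiff ℝ 1 (f ∘ chart e) := hf.comp (chart e).contDiff
  have hc' : HasCompactSupport (f ∘ chart e) := hc.comp_homeomorph (chart e).toHomeomorph
  have h := abs_integral_epigraph_fderiv_le hf' hc' hζ ((chart e).symm u)
  have hd : ∀ p, fderiv ℝ (f ∘ chart e) p ((chart e).symm u) = fderiv ℝ f (chart e p) u := by
    intro p
    rw [(chart e).comp_right_fderiv]
    simp
  simp only [hd] at h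
  rw [chart_symm_apply] at h
  refine le_trans (le_of_eq ?_) h
  congr 1
  -- `D` agrees with the epigraph only inside the ball; outside it both integrands vanish because
  -- `f` does.
  have hind : ∀ p, D.indicator (fun x => fderiv ℝ f x u) (chart e p) =
      {p : ℝ × ℝ | ζ p.1 < p.2}.indicator (fun p => fderiv ℝ f (chart e p) u) p := by
    intro p
    by_cases hp : chart e p ∈ Metric.ball x₀ r
    · have := hgraph _ hp
      simp only [apply_chart_zero, apply_chart_one] at this
      simp [indicator, this]
    · have : fderiv ℝ f (chart e p) = 0 := by
        by_contra h0
        exact hp (hsupp (support_fderiv_subset ℝ h0))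
      simp [indicator, this]
  rw [← integral_indicator hD.measurableSet, ← integral_indicator
    (measurableSet_epigraph hζ.continuous), ← (measurePreserving_chart e).integral_comp
    (chart e).toHomeomorph.measurableEmbedding]
  exact integral_congr_ae (.of_forall hind)

/-- The factor 2 comes from bounding real and imaginary parts separately. -/
theorem norm_setIntegral_fderiv_le {f : Plane → ℂ} (hf : ContDiff ℝ 1 f) (hc : HasCompactSupport f)
    (hsupp : tsupport f ⊆ Metric.ball x₀ r) (hD : IsOpen D) (hζ : LipschitzWith K ζ)
    (hgraph : ∀ y ∈ Metric.ball x₀ r, (y ∈ D ↔ ζ (e y 0) < e y 1)) (u : Plane) :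
    ‖∫ x in D, fderiv ℝ f x u‖ ≤
      2 * (|e u 0| * K + |e u 1|) * ∫ t, ‖f (graphCurve e ζ t)‖ := by
  have hint : Integrable (fun x => fderiv ℝ f x u) (volume.restrict D) :=
    (Continuous.integrable_of_hasCompactSupport
      ((hf.continuous_fderiv one_ne_zero).clm_apply continuous_const)
      (hc.fderiv_apply (𝕜 := ℝ) u)).integrableOn
  have hint' : Integrable (fun t => ‖f (graphCurve e ζ t)‖) := by
    refine (Continuous.integrable_of_hasCompactSupport
      (hf.continuous.comp (continuous_graphCurve hζ.continuous))
      (hc.comp_isClosedEmbedding ?_)).norm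
    exact Function.LeftInverse.isClosedEmbedding (f := fun x => e x 0)
      (fun t => by simp [graphCurve]) (by fun_prop) (continuous_graphCurve hζ.continuous)
  have main : ∀ L : ℂ →L[ℝ] ℝ, (∀ z, |L z| ≤ ‖z‖) → |L (∫ x in D, fderiv ℝ f x u)| ≤
      (|e u 0| * K + |e u 1|) * ∫ t, ‖f (graphCurve e ζ t)‖ := by
    intro L hL
    have hd : ∀ x, L (fderiv ℝ f x u) = fderiv ℝ (L ∘ f) x u := by
      intro x
      rw [fderiv_comp x L.differentiableAt ((hf.differentiable one_ne_zero) x)]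
      simp
    rw [← L.integral_comp_comm hint]
    simp_rw [hd]
    refine (abs_setIntegral_fderiv_le (L.contDiff.comp hf) (hc.comp_left (map_zero L))
      ((closure_mono (Function.support_comp_subset (map_zero L) f)).trans hsupp) hD hζ
      hgraph u).trans ?_
    refine mul_le_mul_of_nonneg_left ?_ (by positivity)
    exact integral_mono_of_nonneg (.of_forall fun _ => abs_nonneg _) hint'
      (.of_forall fun t => hL _)
  have h1 := main Complex.reCLM fun z => Complex.abs_re_le_norm z
  have h2 := main Complex.imCLM fun z => Complex.abs_im_le_norm z
  have h3 := Complex.norm_le_abs_re_add_abs_im (∫ x in D, fderiv ℝ f x u)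
  simp only [Complex.reCLM_apply, Complex.imCLM_apply] at h1 h2
  linarith

end Chart

/-! ### Calculus of test functions. -/

section TestFunction

variable {D U : Set Plane} {φ ψ : Plane → ℝ}

theorem IsTestFunction.mono (h : IsTestFunction D φ) (hDU : D ⊆ U) : IsTestFunction U φ :=
  ⟨h.1, h.2, h.3.trans hDU⟩

theorem IsTestFunction.differentiable (h : IsTestFunction D φ) : Differentiable ℝ φ :=
  h.1.differentiable (by simp)

theorem IsTestFunction.mul_left (h : IsTestFunction D φ) (hψ : ContDiff ℝ ∞ ψ) :
    IsTestFunction D (fun x => ψ x * φ x) :=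
  ⟨hψ.mul h.1, h.2.mul_left, (closure_mono (Function.support_mul_subset_right _ _)).trans h.3⟩

theorem support_partialDeriv_subset {F : Type*} [NormedAddCommGroup F] [NormedSpace ℝ F]
    (i : Fin 2) (f : Plane → F) : Function.support (partialDeriv i f) ⊆ tsupport f := fun x hx =>
  support_fderiv_subset ℝ (fun h => hx (by simp [partialDeriv, h]))

theorem IsTestFunction.partialDeriv (h : IsTestFunction D φ) (i : Fin 2) :
    IsTestFunction D (partialDeriv i φ) := by
  refine ⟨?_, h.2.fderiv_apply (𝕜 := ℝ) _, ?_⟩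
  · exact (h.1.fderiv_right (m := ∞) (by simp)).clm_apply contDiff_const
  · exact (closure_minimal (support_partialDeriv_subset i φ) (isClosed_tsupport φ)).trans h.3

theorem continuous_partialDeriv {F : Type*} [NormedAddCommGroup F] [NormedSpace ℝ F]
    {f : Plane → F} (hf : ContDiff ℝ ∞ f) (i : Fin 2) : Continuous (Helmholtz.partialDeriv i f) :=
  (hf.continuous_fderiv (by simp)).clm_apply continuous_const

theorem partialDeriv_mul {f g : Plane → ℝ} (i : Fin 2) (hf : Differentiable ℝ f)
    (hg : Differentiable ℝ g) (x : Plane) :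
    Helmholtz.partialDeriv i (fun x => f x * g x) x =
      f x * Helmholtz.partialDeriv i g x + Helmholtz.partialDeriv i f x * g x := by
  simp only [Helmholtz.partialDeriv]
  rw [fderiv_fun_mul (hf x) (hg x)]
  simp [mul_comm]

theorem partialDeriv_mul_ofReal {f : Plane → ℂ} {g : Plane → ℝ} (i : Fin 2)
    (hf : Differentiable ℝ f) (hg : Differentiable ℝ g) (x : Plane) :
    Helmholtz.partialDeriv i (fun x => f x * (g x : ℂ)) x =
      f x * (Helmholtz.partialDeriv i g x : ℝ) + Helmholtz.partialDeriv i f x * g x := by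
  simp only [Helmholtz.partialDeriv]
  have h : HasFDerivAt (fun x => (g x : ℂ)) (Complex.ofRealCLM.comp (fderiv ℝ g x)) x :=
    Complex.ofRealCLM.hasFDerivAt.comp x (hg x).hasFDerivAt
  rw [fderiv_fun_mul (hf x) h.differentiableAt, h.fderiv]
  simp [mul_comm]

theorem IsTestFunction.ofReal_memLp (h : IsTestFunction D φ) (p : ℝ≥0∞) {μ : Measure Plane}
    [IsFiniteMeasureOnCompacts μ] : MemLp (fun x => (φ x : ℂ)) p μ :=
  (Complex.continuous_ofReal.comp h.1.continuous).memLp_of_hasCompactSupport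
    (h.2.comp_left Complex.ofReal_zero)

theorem IsTestFunction.memLp (h : IsTestFunction D φ) (p : ℝ≥0∞) {μ : Measure Plane}
    [IsFiniteMeasureOnCompacts μ] : MemLp φ p μ :=
  h.1.continuous.memLp_of_hasCompactSupport h.2

end TestFunction

/-! ### Zero trace and integration by parts up to the boundary. -/

section IntegrationByParts

variable {e : Plane ≃ₗᵢ[ℝ] Plane} {ζ : ℝ → ℝ} {D : Set Plane} {x₀ : Plane} {r : ℝ} {K : NNReal}

/-- Cauchy–Schwarz in the graph parameter, followed by `map_graphCurve_le`. It controls the boundary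
term by the `L²` norm in which the trace is defined. -/
theorem integral_norm_graphCurve_le {φ : Plane → ℂ} {Φ : Plane → ℝ} (hφ : Continuous φ)
    (hD : IsOpen D) (hζ : Continuous ζ)
    (hgraph : ∀ y ∈ Metric.ball x₀ r, (y ∈ D ↔ ζ (e y 0) < e y 1))
    (hΦ : IsTestFunction (Metric.ball x₀ r) Φ) :
    ENNReal.ofReal (∫ t, ‖φ (graphCurve e ζ t) * (Φ (graphCurve e ζ t) : ℂ)‖) ≤
      eLpNorm φ 2 ((μH[1] : Measure Plane).restrict (frontier D ∩ Metric.ball x₀ r)) *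
        eLpNorm (fun t => Φ (graphCurve e ζ t)) 2 volume := by
  have hcont := continuous_graphCurve (e := e) hζ
  set I := graphCurve e ζ ⁻¹' Metric.ball x₀ r
  have hI : MeasurableSet I := (Metric.isOpen_ball.preimage hcont).measurableSet
  have hc' : Continuous (fun t => φ (graphCurve e ζ t) * (Φ (graphCurve e ζ t) : ℂ)) :=
    (hφ.comp hcont).mul (Complex.continuous_ofReal.comp (hΦ.1.continuous.comp hcont))
  rw [ofReal_integral_norm_eq_lintegral_enorm]
  swap
  · refine hc'.integrable_of_hasCompactSupport ?_
    refine HasCompactSupport.mul_left ?_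
    refine (hΦ.2.comp_left (g := ((↑) : ℝ → ℂ)) Complex.ofReal_zero).comp_isClosedEmbedding ?_
    exact Function.LeftInverse.isClosedEmbedding (f := fun x => e x 0)
      (fun t => by simp [graphCurve]) (by fun_prop) hcont
  have h1 : ∫⁻ t, ‖φ (graphCurve e ζ t) * (Φ (graphCurve e ζ t) : ℂ)‖ₑ =
      eLpNorm (fun t => Φ (graphCurve e ζ t) • φ (graphCurve e ζ t)) 1 (volume.restrict I) := by
    rw [eLpNorm_one_eq_lintegral_enorm, ← lintegral_indicator hI]
    refine lintegral_congr fun t => ?_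
    by_cases ht : t ∈ I
    · simp [ht, mul_comm, enorm_mul]
    · have : Φ (graphCurve e ζ t) = 0 := image_eq_zero_of_notMem_tsupport fun h => ht (hΦ.3 h)
      simp [ht, this]
  have h2 := eLpNorm_smul_le_mul_eLpNorm (p := 2) (q := 2) (r := 1) (μ := volume.restrict I)
    (hφ.comp hcont).aestronglyMeasurable (hΦ.1.continuous.comp hcont).aestronglyMeasurable
  rw [h1, mul_comm]
  refine h2.trans ?_
  refine mul_le_mul' (eLpNorm_mono_measure _ Measure.restrict_le_self) ?_
  rw [← eLpNorm_map_measure hφ.aestronglyMeasurable hcont.aemeasurable]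
  exact eLpNorm_mono_measure _ (map_graphCurve_le hD hζ hgraph)

/-- Integration by parts, without a boundary term, against a test function that need not vanish
near the boundary. -/
theorem setIntegral_mul_partialDeriv_of_zero_trace {v g : Plane → ℂ} {G : Fin 2 → Plane → ℂ}
    {φ : ℕ → Plane → ℂ} (hD : IsOpen D) (hζ : LipschitzWith K ζ)
    (hgraph : ∀ y ∈ Metric.ball x₀ r, (y ∈ D ↔ ζ (e y 0) < e y 1))
    (hv : IsH1WithGradient D v G) (hφ : ∀ n, ContDiff ℝ ∞ (φ n))
    (hφv : Tendsto (fun n => eLpNorm (φ n - v) 2 (volume.restrict D)) atTop (𝓝 0))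
    (hφG : ∀ i, Tendsto (fun n => eLpNorm (partialDeriv i (φ n) - G i) 2 (volume.restrict D))
      atTop (𝓝 0))
    (hφg : Tendsto (fun n => eLpNorm (φ n - g) 2 ((μH[1] : Measure Plane).restrict (frontier D)))
      atTop (𝓝 0))
    (hg : ∀ᵐ x ∂((μH[1] : Measure Plane).restrict (frontier D ∩ Metric.ball x₀ r)), g x = 0)
    (i : Fin 2) {Φ : Plane → ℝ} (hΦ : IsTestFunction (Metric.ball x₀ r) Φ) :
    ∫ x in D, v x * ((partialDeriv i Φ x : ℝ) : ℂ) = -∫ x in D, G i x * (Φ x : ℂ) := by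
  -- The limit of `∫ ∂ᵢ(φₙ Φ)` is computed twice: by the product rule and `L²` convergence here, and
  -- as zero by the boundary estimate in `hz`.
  have hlim : Tendsto (fun n => ∫ x in D, partialDeriv i (fun x => φ n x * (Φ x : ℂ)) x) atTop
      (𝓝 ((∫ x in D, v x * ((partialDeriv i Φ x : ℝ) : ℂ)) + ∫ x in D, G i x * (Φ x : ℂ))) := by
    have h1 := tendsto_integral_mul_of_tendsto_eLpNorm
      (fun n => (hφ n).continuous.aestronglyMeasurable) hv.memLp
      ((hΦ.partialDeriv i).ofReal_memLp 2) hφv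
    have h2 := tendsto_integral_mul_of_tendsto_eLpNorm
      (fun n => (continuous_partialDeriv (hφ n) i).aestronglyMeasurable) (hv.memLp_gradient i)
      (hΦ.ofReal_memLp 2) (hφG i)
    refine (h1.add h2).congr fun n => ?_
    have hint : ∀ {a : Plane → ℂ} {b : Plane → ℝ}, Continuous a →
        IsTestFunction (Metric.ball x₀ r) b →
        Integrable (fun x => a x * (b x : ℂ)) (volume.restrict D) := fun ha hb =>
      ((ha.mul (Complex.continuous_ofReal.comp hb.1.continuous)).integrable_of_hasCompactSupport
        (HasCompactSupport.mul_left (hb.2.comp_left Complex.ofReal_zero))).integrableOn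
    rw [← integral_add (hint (hφ n).continuous (hΦ.partialDeriv i))
      (hint (continuous_partialDeriv (hφ n) i) hΦ)]
    refine integral_congr_ae (.of_forall fun x => ?_)
    exact (partialDeriv_mul_ofReal i ((hφ n).differentiable (by simp)) hΦ.differentiable x).symm
  -- Inside the ball `g` vanishes a.e. on the boundary, so there the `φₙ` themselves tend to zero.
  have hb : Tendsto (fun n => eLpNorm (φ n) 2
      ((μH[1] : Measure Plane).restrict (frontier D ∩ Metric.ball x₀ r))) atTop (𝓝 0) := by
    refine tendsto_of_tendsto_of_tendsto_of_le_of_le tendsto_const_nhds hφg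
      (fun n => bot_le) fun n => ?_
    calc _ = eLpNorm (φ n - g) 2
          ((μH[1] : Measure Plane).restrict (frontier D ∩ Metric.ball x₀ r)) := by
          refine eLpNorm_congr_ae ?_
          filter_upwards [hg] with x hx
          simp [hx]
      _ ≤ _ := eLpNorm_mono_measure _ (Measure.restrict_mono inter_subset_left le_rfl)
  have hfin : eLpNorm (fun t => Φ (graphCurve e ζ t)) 2 volume ≠ ⊤ := by
    have hcont := continuous_graphCurve (e := e) hζ.continuous
    refine ((hΦ.1.continuous.comp hcont).memLp_of_hasCompactSupport (hΦ.2.comp_isClosedEmbedding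
      ?_)).2.ne
    exact Function.LeftInverse.isClosedEmbedding (f := fun x => e x 0)
      (fun t => by simp [graphCurve]) (by fun_prop) hcont
  have hcurve : Tendsto (fun n => ∫ t, ‖φ n (graphCurve e ζ t) * (Φ (graphCurve e ζ t) : ℂ)‖)
      atTop (𝓝 0) := by
    have h0 : Tendsto (fun n => ENNReal.ofReal
        (∫ t, ‖φ n (graphCurve e ζ t) * (Φ (graphCurve e ζ t) : ℂ)‖)) atTop (𝓝 0) := by
      refine tendsto_of_tendsto_of_tendsto_of_le_of_le tendsto_const_nhds ?_ (fun n => bot_le)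
        fun n => integral_norm_graphCurve_le (hφ n).continuous hD hζ.continuous hgraph hΦ
      simpa using ENNReal.Tendsto.mul_const hb (.inr hfin)
    have := (ENNReal.tendsto_toReal ENNReal.zero_ne_top).comp h0
    refine this.congr fun n => ?_
    simp only [Function.comp_apply]
    exact ENNReal.toReal_ofReal (integral_nonneg fun _ => norm_nonneg _)
  set u : Plane := EuclideanSpace.single i (1 : ℝ)
  have hz : Tendsto (fun n => ∫ x in D, partialDeriv i (fun x => φ n x * (Φ x : ℂ)) x) atTop
      (𝓝 0) := by
    refine squeeze_zero_norm (fun n => norm_setIntegral_fderiv_le ?_ ?_ ?_ hD hζ hgraph u)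
      (a := fun n => _) ?_
    · exact ((hφ n).mul (Complex.ofRealCLM.contDiff.comp hΦ.1)).of_le (by simp)
    · exact HasCompactSupport.mul_left (hΦ.2.comp_left (g := ((↑) : ℝ → ℂ)) Complex.ofReal_zero)
    · refine (closure_mono ?_).trans hΦ.3
      intro x hx h
      exact hx (by simp [h])
    · simpa using hcurve.const_mul (2 * (|e u 0| * K + |e u 1|))
  exact eq_neg_of_add_eq_zero_left (tendsto_nhds_unique hlim hz)

end IntegrationByParts

/-! ### Correlations of `L²` functions. -/

section Correlation

theorem MemLp.comp_sub_right {E : Type*} [NormedAddCommGroup E] {b : Plane → E} {p : ℝ≥0∞}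
    (hb : MemLp b p) (y : Plane) : MemLp (fun x => b (x - y)) p :=
  hb.comp_measurePreserving (measurePreserving_sub_right volume y)

/-- The integral is the `L²` inner product of `conj a` with a translate of `b`, and translation acts
continuously on `L²`. -/
theorem continuous_integral_mul_translate {a b : Plane → ℂ} (ha : MemLp a 2) (hb : MemLp b 2) :
    Continuous (fun y => ∫ x, a x * b (x - y)) := by
  have hmp : ∀ y : Plane, MeasurePreserving (fun x : Plane => x - y) :=
    measurePreserving_sub_right volume
  let τ : C(Plane × Plane, Plane) := ⟨fun p => p.2 - p.1, by fun_prop⟩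
  have hcont : Continuous (fun y => Lp.compMeasurePreserving (τ.curry y) (hmp y) hb.toLp) :=
    continuous_const.compMeasurePreservingLp τ.curry.continuous hmp (by simp)
  have hac : MemLp (fun x => (starRingEnd ℂ) (a x)) 2 :=
    Complex.conjCLE.toContinuousLinearMap.comp_memLp' ha
  refine ((continuous_const (y := hac.toLp)).inner hcont (𝕜 := ℂ)).congr fun y => ?_
  rw [L2.inner_def]
  refine integral_congr_ae ?_
  have h2 := Lp.coeFn_compMeasurePreserving hb.toLp (hmp y)
  have h3 := (hmp y).quasiMeasurePreserving.ae_eq_comp hb.coeFn_toLp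
  filter_upwards [hac.coeFn_toLp, h2, h3] with x hx1 hx2 hx3
  have h4 : (Lp.compMeasurePreserving (τ.curry y) (hmp y) hb.toLp) x = b (x - y) :=
    hx2.trans hx3
  rw [h4, hx1]
  simp [mul_comm]

variable {a : Plane → ℂ} {b ρ : Plane → ℝ} {D : Set Plane}

theorem integral_mul_correlation (ha : MemLp a 2) (hb : MemLp b 2) (hρ : IsTestFunction D ρ) :
    ∫ y, (ρ y : ℂ) * ∫ x, a x * (b (x - y) : ℂ) =
      ∫ x, a x * ((∫ y, ρ y * b (x - y) : ℝ) : ℂ) := by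
  have hb' : MemLp (fun x => (b x : ℂ)) 2 := hb.ofReal
  have hint : Integrable (Function.uncurry fun y x => (ρ y : ℂ) * (a x * (b (x - y) : ℂ)))
      (volume.prod volume) := by
    rw [integrable_prod_iff]
    · constructor
      · refine .of_forall fun y => Integrable.const_mul ?_ (ρ y : ℂ)
        exact ha.integrable_mul (MemLp.comp_sub_right hb' y)
      -- The inner integrals of absolute values form a correlation of `‖a‖` and `‖b‖`; this is
      -- continuous, so its product with the compactly supported `|ρ|` is integrable.
      · have hc : Continuous (fun y => ‖(ρ y : ℂ)‖ *
            ‖∫ x, ((‖a x‖ : ℝ) : ℂ) * ((‖b (x - y)‖ : ℝ) : ℂ)‖) :=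
          (Complex.continuous_ofReal.comp hρ.1.continuous).norm.mul
            (continuous_integral_mul_translate ha.norm.ofReal hb.norm.ofReal).norm
        refine (hc.integrable_of_hasCompactSupport (HasCompactSupport.mul_right
          ((hρ.2.comp_left Complex.ofReal_zero).norm))).congr (.of_forall fun y => ?_)
        simp only [Function.uncurry_apply_pair, norm_mul, Complex.norm_real]
        rw [integral_const_mul]
        congr 1
        simp_rw [← Complex.ofReal_mul]
        rw [integral_complex_ofReal, Complex.norm_real]
        exact abs_of_nonneg (integral_nonneg fun x => by positivity)
    · have h1 : AEStronglyMeasurable (fun p : Plane × Plane => (ρ p.1 : ℂ))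
          (volume.prod volume) :=
        (Complex.continuous_ofReal.comp (hρ.1.continuous.comp
          continuous_fst)).aestronglyMeasurable
      have h2 : AEStronglyMeasurable (fun p : Plane × Plane => (b (p.2 - p.1) : ℂ))
          (volume.prod volume) := by
        have h := hb'.1.comp_quasiMeasurePreserving
          (quasiMeasurePreserving_sub_of_right_invariant volume volume)
        exact (Measure.measurePreserving_swap.aestronglyMeasurable_comp_iff
          MeasurableEquiv.prodComm.measurableEmbedding).2 h
      exact h1.mul (ha.1.comp_snd.mul h2)
  calc _ = ∫ y, ∫ x, (ρ y : ℂ) * (a x * (b (x - y) : ℂ)) := by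
        simp_rw [integral_const_mul]
    _ = ∫ x, ∫ y, (ρ y : ℂ) * (a x * (b (x - y) : ℂ)) := integral_integral_swap hint
    _ = _ := by
        refine integral_congr_ae (.of_forall fun x => ?_)
        simp only
        rw [← integral_complex_ofReal, ← integral_const_mul]
        refine integral_congr_ae (.of_forall fun y => ?_)
        simp only
        push_cast
        ring

end Correlation

/-! ### Testing the equation with translated, mollified Sobolev functions. -/

section Mollification

variable {w ρ : Plane → ℝ} {g : Fin 2 → Plane → ℝ} {S Y D : Set Plane}

theorem partialDeriv_convolution (hw : LocallyIntegrable w) (hρ : IsTestFunction Y ρ)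
    (hweak : ∀ i ψ, IsTestFunction univ ψ → ∫ x, w x * partialDeriv i ψ x = -∫ x, g i x * ψ x)
    (i : Fin 2) (x : Plane) :
    partialDeriv i (fun x => ∫ y, ρ y * w (x - y)) x = ∫ y, ρ y * g i (x - y) := by
  have hd := hρ.2.hasFDerivAt_convolution_left (ContinuousLinearMap.mul ℝ ℝ)
    (hρ.1.of_le (by simp)) hw x
  have hex := (hρ.2.fderiv (𝕜 := ℝ)).convolutionExists_left
    ((ContinuousLinearMap.mul ℝ ℝ).precompL Plane) (hρ.1.continuous_fderiv (by simp)) hw x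
  have h1 : partialDeriv i (fun x => ∫ y, ρ y * w (x - y)) x =
      ∫ y, partialDeriv i ρ y * w (x - y) := by
    have hd' : HasFDerivAt (fun x => ∫ y, ρ y * w (x - y)) _ x := hd
    rw [partialDeriv, hd'.fderiv, convolution_def, ContinuousLinearMap.integral_apply hex]
    simp [partialDeriv]
  have hψ : IsTestFunction univ (fun z => ρ (x - z)) :=
    ⟨hρ.1.comp (by fun_prop), hρ.2.comp_homeomorph (Homeomorph.subLeft x), subset_univ _⟩
  have hdψ : ∀ z, partialDeriv i (fun z => ρ (x - z)) z = -partialDeriv i ρ (x - z) := by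
    intro z
    have := (hρ.differentiable (x - z)).hasFDerivAt.comp z
      ((hasFDerivAt_id z).const_sub x)
    have h' : HasFDerivAt (fun z => ρ (x - z)) _ z := this
    rw [partialDeriv, h'.fderiv]
    simp [partialDeriv]
  have h2 := hweak i _ hψ
  simp only [hdψ, mul_neg, integral_neg, neg_inj] at h2
  rw [h1, ← integral_sub_left_eq_self (fun y => partialDeriv i ρ y * w (x - y)) volume x,
    ← integral_sub_left_eq_self (fun y => ρ y * g i (x - y)) volume x]
  simp only [sub_sub_cancel]
  simpa only [mul_comm] using h2

open scoped Pointwise in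
theorem isTestFunction_convolution (hw : LocallyIntegrable w) (hρ : IsTestFunction Y ρ)
    (hS : IsCompact S) (hwS : ∀ x ∉ S, w x = 0) (hSY : ∀ x ∈ S, ∀ y ∈ Y, x + y ∈ D) :
    IsTestFunction D (fun x => ∫ y, ρ y * w (x - y)) := by
  have hcomp : IsCompact (S + tsupport ρ) := hS.add hρ.2
  have hsupp : tsupport (fun x => ∫ y, ρ y * w (x - y)) ⊆ S + tsupport ρ := by
    refine closure_minimal (fun x hx => ?_) hcomp.isClosed
    by_contra hxS
    refine hx (integral_eq_zero_of_ae (.of_forall fun y => ?_))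
    simp only [Pi.zero_apply, mul_eq_zero]
    by_contra! h
    refine hxS ⟨x - y, by_contra fun h' => h.2 (hwS _ h'), y, subset_tsupport _ h.1, by simp⟩
  refine ⟨?_, hcomp.of_isClosed_subset (isClosed_tsupport _) hsupp, fun x hx => ?_⟩
  · exact hρ.2.contDiff_convolution_left (ContinuousLinearMap.mul ℝ ℝ) hρ.1 hw
  · obtain ⟨s, hs, y, hy, rfl⟩ := hsupp hx
    exact hSY s hs y (hρ.3 hy)

/-- A weak solution tested against a Sobolev function whose support can be moved into the domain
by arbitrarily small translations. -/
theorem sum_integral_mul_eq_of_translate {V : Plane → ℂ} {W : Fin 2 → Plane → ℂ} {κ : ℂ}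
    (hV : MemLp V 2) (hW : ∀ i, MemLp (W i) 2)
    (hsol : ∀ ψ, IsTestFunction D ψ →
      ∑ i, ∫ x, W i x * ((partialDeriv i ψ x : ℝ) : ℂ) = κ * ∫ x, V x * (ψ x : ℂ))
    (hw : MemLp w 2) (hg : ∀ i, MemLp (g i) 2)
    (hweak : ∀ i ψ, IsTestFunction univ ψ → ∫ x, w x * partialDeriv i ψ x = -∫ x, g i x * ψ x)
    (hS : IsCompact S) (hwS : ∀ x ∉ S, w x = 0) (hY : IsOpen Y) (hY0 : 0 ∈ closure Y)
    (hSY : ∀ x ∈ S, ∀ y ∈ Y, x + y ∈ D) :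
    ∑ i, ∫ x, W i x * (g i x : ℂ) = κ * ∫ x, V x * (w x : ℂ) := by
  -- `F y` is the defect of the weak equation tested with `w` translated by `y`; the goal is `F 0 =
  -- 0`.
  set F : Plane → ℂ := fun y =>
    (∑ i, ∫ x, W i x * (g i (x - y) : ℂ)) - κ * ∫ x, V x * (w (x - y) : ℂ) with hF
  have hcg : ∀ i, Continuous fun y => ∫ x, W i x * (g i (x - y) : ℂ) := fun i =>
    continuous_integral_mul_translate (hW i) (hg i).ofReal
  have hcw : Continuous fun y => ∫ x, V x * (w (x - y) : ℂ) :=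
    continuous_integral_mul_translate hV hw.ofReal
  have hFc : Continuous F :=
    (continuous_finsetSum _ fun i _ => hcg i).sub (continuous_const.mul hcw)
  have hwl : LocallyIntegrable w := hw.locallyIntegrable (by norm_num)
  -- By Fubini, the average of `F` against `ρ` is the defect for the convolution `ρ * w`, an
  -- admissible test function when `ρ` is supported in `Y`. Thus no limit of mollifiers has to be
  -- taken.
  have hzero : ∀ᵐ y, y ∈ Y → F y = 0 := by
    refine hY.ae_eq_zero_of_integral_contDiff_smul_eq_zero
      (hFc.locallyIntegrable.locallyIntegrableOn _) fun ρ h1 h2 h3 => ?_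
    have hρ : IsTestFunction Y ρ := ⟨h1, h2, h3⟩
    have hint : ∀ {c : Plane → ℂ}, Continuous c → Integrable (fun y => (ρ y : ℂ) * c y) :=
      fun hc => (((Complex.continuous_ofReal.comp h1.continuous).mul
        hc).integrable_of_hasCompactSupport
        (HasCompactSupport.mul_right (h2.comp_left Complex.ofReal_zero)))
    have hψ := hsol _ (isTestFunction_convolution hwl hρ hS hwS hSY)
    simp only [partialDeriv_convolution hwl hρ hweak] at hψ
    calc ∫ y, ρ y • F y = ∫ y, ((∑ i, (ρ y : ℂ) * ∫ x, W i x * (g i (x - y) : ℂ)) -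
          κ * ((ρ y : ℂ) * ∫ x, V x * (w (x - y) : ℂ))) := by
          refine integral_congr_ae (.of_forall fun y => ?_)
          simp only [hF, Complex.real_smul, mul_sub, Finset.mul_sum]
          ring
      _ = 0 := by
          rw [integral_sub (integrable_finsetSum _ fun i _ => hint (hcg i))
            ((hint hcw).const_mul _), integral_finsetSum _ fun i _ => hint (hcg i),
            integral_const_mul, integral_mul_correlation hV hw hρ]
          simp_rw [fun i => integral_mul_correlation (hW i) (hg i) hρ]
          exact sub_eq_zero.2 hψ
  have hEq : EqOn F 0 Y := by
    refine Measure.eqOn_open_of_ae_eq (μ := volume) ?_ hY hFc.continuousOn continuousOn_const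
    exact (ae_restrict_iff' hY.measurableSet).2 hzero
  have h0 := hEq.closure hFc continuous_const hY0
  simpa [hF, sub_eq_zero] using h0

end Mollification

/-! ### From the distributional to the weak form of the equation. -/

section WeakForm

variable {D P : Set Plane} {k : ℂ} {v : Plane → ℂ} {G : Fin 2 → Plane → ℂ}

theorem laplacian_eq_sum_partialDeriv {φ : Plane → ℝ} (hφ : ContDiff ℝ ∞ φ) (x : Plane) :
    Laplacian.laplacian φ x = ∑ i, partialDeriv i (partialDeriv i φ) x := by
  rw [InnerProductSpace.laplacian_eq_iteratedFDeriv_orthonormalBasis φ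
    (EuclideanSpace.basisFun (Fin 2) ℝ)]
  refine Finset.sum_congr rfl fun i _ => ?_
  rw [iteratedFDeriv_two_apply]
  simp only [partialDeriv, EuclideanSpace.basisFun_apply, Matrix.cons_val_zero,
    Matrix.cons_val_one]
  have hd : DifferentiableAt ℝ (fderiv ℝ φ) x :=
    ((hφ.fderiv_right (m := ∞) (by simp)).differentiable (by simp)) x
  rw [show partialDeriv i φ =
    fun x => (fderiv ℝ φ x) ((fun _ => EuclideanSpace.single i 1) x) from rfl,
    fderiv_clm_apply hd (differentiableAt_const _)]
  simp

/-- Each `∂ᵢψ` is again a test function, so the definition of the weak gradient absorbs one of the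
two derivatives in the Laplacian. -/
theorem SolvesHelmholtz.sum_integral_gradient_mul (hsol : SolvesHelmholtz k P v)
    (hP : MeasurableSet P) (hDP : D ⊆ P) (hv : IsH1WithGradient D v G) {ψ : Plane → ℝ}
    (hψ : IsTestFunction D ψ) :
    ∑ i, ∫ x in D, G i x * ((partialDeriv i ψ x : ℝ) : ℂ) =
      k ^ 2 * ∫ x in D, v x * (ψ x : ℂ) := by
  have h0 := hsol ψ (hψ.mono hDP)
  have hint : ∀ {b : Plane → ℝ}, IsTestFunction D b →
      Integrable (fun x => v x * (b x : ℂ)) (volume.restrict D) := fun hb =>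
    hv.memLp.integrable_mul (hb.ofReal_memLp 2)
  have h1 : ∫ x in P, v x * (((Laplacian.laplacian ψ x : ℝ) : ℂ) + k ^ 2 * (ψ x : ℂ)) =
      ∫ x in D, ((∑ i, v x * ((partialDeriv i (partialDeriv i ψ) x : ℝ) : ℂ)) +
        k ^ 2 * (v x * (ψ x : ℂ))) := by
    rw [← setIntegral_eq_of_subset_of_forall_sdiff_eq_zero hP hDP]
    · refine integral_congr_ae (.of_forall fun x => ?_)
      simp only [laplacian_eq_sum_partialDeriv hψ.1]
      push_cast
      rw [mul_add, Finset.mul_sum]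
      ring
    · intro x hx
      have h2 : ∀ i, partialDeriv i (partialDeriv i ψ) x = 0 := fun i =>
        image_eq_zero_of_notMem_tsupport fun h => hx.2 (((hψ.partialDeriv i).partialDeriv i).3 h)
      have h3 : ψ x = 0 := image_eq_zero_of_notMem_tsupport fun h => hx.2 (hψ.3 h)
      simp [h2, h3]
  rw [h1, integral_add (integrable_finsetSum _ fun i _ =>
    hint ((hψ.partialDeriv i).partialDeriv i)) ((hint hψ).const_mul _),
    integral_finsetSum _ fun i _ => hint ((hψ.partialDeriv i).partialDeriv i),
    integral_const_mul] at h0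
  simp_rw [fun i => hv.integral_eq i _ (hψ.partialDeriv i)] at h0
  rw [Finset.sum_neg_distrib] at h0
  linear_combination -h0

end WeakForm

/-! ### Green's identity when the support can be moved inside. -/

section LocalEnergy

variable {D U Y : Set Plane} {k : ℂ} {v : Plane → ℂ} {G : Fin 2 → Plane → ℂ} {η : Plane → ℝ}

theorem memLp_testFunction_mul {E : Type*} [NormedAddCommGroup E] [NormedSpace ℝ E]
    {f : Plane → E} {μ : Measure Plane} [IsFiniteMeasureOnCompacts μ] (hη : IsTestFunction U η)
    (hf : MemLp f 2 μ) : MemLp (fun x => η x • f x) 2 μ :=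
  MemLp.smul (p := ⊤) (q := 2) hf (hη.memLp ⊤)

/-- Test functions are real-valued, so real and imaginary parts of `v` are tested separately; `L`
stands for either. -/
theorem sum_integral_gradient_mul_clm (L : ℂ →L[ℝ] ℝ) (hDb : Bornology.IsBounded D)
    (hDo : IsOpen D) (hv : IsH1WithGradient D v G)
    (hsol : ∀ ψ, IsTestFunction D ψ →
      ∑ i, ∫ x in D, G i x * ((partialDeriv i ψ x : ℝ) : ℂ) = k ^ 2 * ∫ x in D, v x * (ψ x : ℂ))
    (hibp : ∀ i Φ, IsTestFunction U Φ →
      ∫ x in D, v x * ((partialDeriv i Φ x : ℝ) : ℂ) = -∫ x in D, G i x * (Φ x : ℂ))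
    (hη : IsTestFunction U η) (hY : IsOpen Y) (hY0 : 0 ∈ closure Y)
    (hmove : ∀ x ∈ closure D ∩ tsupport η, ∀ y ∈ Y, x + y ∈ D) :
    ∑ i, ∫ x in D, G i x * ((η x * L (G i x) + partialDeriv i η x * L (v x) : ℝ) : ℂ) =
      k ^ 2 * ∫ x in D, v x * ((η x * L (v x) : ℝ) : ℂ) := by
  have hm := hDo.measurableSet
  set w : Plane → ℝ := D.indicator fun x => η x * L (v x)
  set g : Fin 2 → Plane → ℝ := fun i =>
    D.indicator fun x => η x * L (G i x) + partialDeriv i η x * L (v x)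
  have hLv : MemLp (fun x => L (v x)) 2 (volume.restrict D) := L.comp_memLp' hv.memLp
  have hLG : ∀ i, MemLp (fun x => L (G i x)) 2 (volume.restrict D) := fun i =>
    L.comp_memLp' (hv.memLp_gradient i)
  have hw : MemLp w 2 := (memLp_indicator_iff_restrict hm).2 (memLp_testFunction_mul hη hLv)
  have hg : ∀ i, MemLp (g i) 2 := fun i => (memLp_indicator_iff_restrict hm).2
    ((memLp_testFunction_mul hη (hLG i)).add (memLp_testFunction_mul (hη.partialDeriv i) hLv))
  have hindR : ∀ f h : Plane → ℝ, ∫ x, D.indicator f x * h x = ∫ x in D, f x * h x := by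
    intro f h
    rw [← integral_indicator hm]
    simp_rw [indicator_mul_left]
  have hindC : ∀ f h : Plane → ℂ, ∫ x, D.indicator f x * h x = ∫ x in D, f x * h x := by
    intro f h
    rw [← integral_indicator hm]
    simp_rw [indicator_mul_left]
  -- The zero extension creates no boundary contribution: `hibp` is applied to `ψ η`, which need not
  -- vanish on the boundary of `D`, and the product rule does the rest.
  have hweak : ∀ i ψ, IsTestFunction univ ψ →
      ∫ x, w x * partialDeriv i ψ x = -∫ x, g i x * ψ x := by
    intro i ψ hψ
    have hψη : IsTestFunction U (fun x => ψ x * η x) := hη.mul_left hψ.1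
    have h1 := congrArg L (hibp i _ hψη)
    have hJ1 : Integrable (fun x => v x *
        ((partialDeriv i (fun x => ψ x * η x) x : ℝ) : ℂ)) (volume.restrict D) :=
      hv.memLp.integrable_mul ((hψη.partialDeriv i).ofReal_memLp 2)
    have hJ2 : Integrable (fun x => G i x * ((ψ x * η x : ℝ) : ℂ)) (volume.restrict D) :=
      (hv.memLp_gradient i).integrable_mul (hψη.ofReal_memLp 2)
    rw [map_neg, ← L.integral_comp_comm hJ1, ← L.integral_comp_comm hJ2] at h1
    have hLmul : ∀ (z : ℂ) (c : ℝ), L (z * c) = L z * c := by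
      intro z c
      rw [mul_comm z, ← Complex.real_smul, map_smul, smul_eq_mul, mul_comm]
    simp only [hLmul] at h1
    have hI1 : Integrable (fun x => η x * L (v x) * partialDeriv i ψ x) (volume.restrict D) :=
      (memLp_testFunction_mul hη hLv).integrable_mul ((hψ.partialDeriv i).memLp 2)
    have hI2 : Integrable (fun x => partialDeriv i η x * L (v x) * ψ x) (volume.restrict D) :=
      (memLp_testFunction_mul (hη.partialDeriv i) hLv).integrable_mul (hψ.memLp 2)
    have hI3 : Integrable (fun x => η x * L (G i x) * ψ x) (volume.restrict D) :=
      (memLp_testFunction_mul hη (hLG i)).integrable_mul (hψ.memLp 2)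
    have h2 : ∫ x in D, L (v x) * partialDeriv i (fun x => ψ x * η x) x =
        (∫ x in D, η x * L (v x) * partialDeriv i ψ x) +
          ∫ x in D, partialDeriv i η x * L (v x) * ψ x := by
      rw [← integral_add hI1 hI2]
      refine integral_congr_ae (.of_forall fun x => ?_)
      simp only [partialDeriv_mul i hψ.differentiable hη.differentiable]
      ring
    have h3 : ∫ x in D, L (G i x) * (ψ x * η x) = ∫ x in D, η x * L (G i x) * ψ x :=
      integral_congr_ae (.of_forall fun x => by ring)
    rw [h2, h3] at h1
    rw [hindR, hindR]
    simp_rw [add_mul]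
    rw [integral_add hI3 hI2]
    linarith
  have hsol' : ∀ ψ, IsTestFunction D ψ →
      ∑ i, ∫ x, D.indicator (G i) x * ((partialDeriv i ψ x : ℝ) : ℂ) =
        k ^ 2 * ∫ x, D.indicator v x * (ψ x : ℂ) := by
    intro ψ hψ
    simp_rw [hindC]
    exact hsol ψ hψ
  have key := sum_integral_mul_eq_of_translate
    ((memLp_indicator_iff_restrict hm).2 hv.memLp)
    (fun i => (memLp_indicator_iff_restrict hm).2 (hv.memLp_gradient i)) hsol' hw hg hweak
    (hDb.isCompact_closure.inter_right (isClosed_tsupport η)) ?_ hY hY0 hmove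
  · simp_rw [hindC] at key
    rw [setIntegral_congr_fun (g := fun x => v x * ((η x * L (v x) : ℝ) : ℂ)) hm] at key
    · rw [← key]
      refine Finset.sum_congr rfl fun i _ => setIntegral_congr_fun hm fun x hx => ?_
      simp [g, hx]
    · intro x hx
      simp [w, hx]
  · intro x hx
    by_cases hxD : x ∈ D
    · have : η x = 0 := image_eq_zero_of_notMem_tsupport fun h => hx ⟨subset_closure hxD, h⟩
      simp [w, this]
    · simp [w, hxD]

/-- The difference of the two sides of Green's identity for `v` tested against `η v`. -/
noncomputable def energyDefect (k : ℂ) (D : Set Plane) (v : Plane → ℂ) (G : Fin 2 → Plane → ℂ)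
    (η : Plane → ℝ) : ℂ :=
  ∫ x in D, ((∑ i, G i x * (η x * starRingEnd ℂ (G i x) +
    (partialDeriv i η x : ℝ) * starRingEnd ℂ (v x))) - k ^ 2 * (η x * (v x * starRingEnd ℂ (v x))))

theorem integrable_energyDefect_gradient (hv : IsH1WithGradient D v G) (hη : IsTestFunction U η)
    (i : Fin 2) : Integrable (fun x => G i x * (η x * starRingEnd ℂ (G i x) +
      (partialDeriv i η x : ℝ) * starRingEnd ℂ (v x))) (volume.restrict D) := by
  have h1 := memLp_testFunction_mul hη
    (Complex.conjCLE.toContinuousLinearMap.comp_memLp' (hv.memLp_gradient i))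
  have h2 := memLp_testFunction_mul (hη.partialDeriv i)
    (Complex.conjCLE.toContinuousLinearMap.comp_memLp' hv.memLp)
  exact (hv.memLp_gradient i).integrable_mul (h1.add h2)

theorem integrable_energyDefect_mass (hv : IsH1WithGradient D v G) (hη : IsTestFunction U η) :
    Integrable (fun x => η x * (v x * starRingEnd ℂ (v x))) (volume.restrict D) := by
  have h1 := memLp_testFunction_mul hη
    (Complex.conjCLE.toContinuousLinearMap.comp_memLp' hv.memLp)
  refine (hv.memLp.integrable_mul h1).congr (.of_forall fun x => ?_)
  simp only [Pi.mul_apply, Complex.real_smul, ContinuousLinearEquiv.coe_coe,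
    Function.comp_apply, Complex.conjCLE_apply]
  ring

theorem integrable_energyDefect (hv : IsH1WithGradient D v G) (hη : IsTestFunction U η) :
    Integrable (fun x => (∑ i, G i x * (η x * starRingEnd ℂ (G i x) +
      (partialDeriv i η x : ℝ) * starRingEnd ℂ (v x))) -
        k ^ 2 * (η x * (v x * starRingEnd ℂ (v x)))) (volume.restrict D) :=
  (integrable_finsetSum _ fun i _ => integrable_energyDefect_gradient hv hη i).sub
    ((integrable_energyDefect_mass hv hη).const_mul _)

/-- Since `conj z = re z - i im z`, the identity for the imaginary part, times `i`, is subtracted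
from that for the real part. -/
theorem energyDefect_eq_zero_of_translate (hDb : Bornology.IsBounded D)
    (hDo : IsOpen D) (hv : IsH1WithGradient D v G)
    (hsol : ∀ ψ, IsTestFunction D ψ →
      ∑ i, ∫ x in D, G i x * ((partialDeriv i ψ x : ℝ) : ℂ) = k ^ 2 * ∫ x in D, v x * (ψ x : ℂ))
    (hibp : ∀ i Φ, IsTestFunction U Φ →
      ∫ x in D, v x * ((partialDeriv i Φ x : ℝ) : ℂ) = -∫ x in D, G i x * (Φ x : ℂ))
    (hη : IsTestFunction U η) (hY : IsOpen Y) (hY0 : 0 ∈ closure Y)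
    (hmove : ∀ x ∈ closure D ∩ tsupport η, ∀ y ∈ Y, x + y ∈ D) :
    energyDefect k D v G η = 0 := by
  have hre := sum_integral_gradient_mul_clm Complex.reCLM hDb hDo hv hsol hibp hη hY hY0 hmove
  have him := sum_integral_gradient_mul_clm Complex.imCLM hDb hDo hv hsol hibp hη hY hY0 hmove
  have hconj : ∀ z : ℂ, starRingEnd ℂ z = z.re - Complex.I * z.im := fun z => by
    apply Complex.ext <;> simp
  have hLv : ∀ L : ℂ →L[ℝ] ℝ, MemLp (fun x => L (v x)) 2 (volume.restrict D) := fun L =>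
    L.comp_memLp' hv.memLp
  have hLG : ∀ (L : ℂ →L[ℝ] ℝ) i, MemLp (fun x => L (G i x)) 2 (volume.restrict D) := fun L i =>
    L.comp_memLp' (hv.memLp_gradient i)
  have hIG : ∀ (L : ℂ →L[ℝ] ℝ) i, Integrable (fun x => G i x *
      ((η x * L (G i x) + partialDeriv i η x * L (v x) : ℝ) : ℂ)) (volume.restrict D) :=
    fun L i => (hv.memLp_gradient i).integrable_mul ((memLp_testFunction_mul hη (hLG L i)).add
      (memLp_testFunction_mul (hη.partialDeriv i) (hLv L))).ofReal
  have hIv : ∀ (L : ℂ →L[ℝ] ℝ), Integrable (fun x => v x *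
      ((η x * L (v x) : ℝ) : ℂ)) (volume.restrict D) :=
    fun L => hv.memLp.integrable_mul (memLp_testFunction_mul hη (hLv L)).ofReal
  have hG : ∀ i, ∫ x in D, G i x * (η x * starRingEnd ℂ (G i x) +
      (partialDeriv i η x : ℝ) * starRingEnd ℂ (v x)) =
      (∫ x in D, G i x * ((η x * Complex.reCLM (G i x) +
        partialDeriv i η x * Complex.reCLM (v x) : ℝ) : ℂ)) - Complex.I *
      ∫ x in D, G i x * ((η x * Complex.imCLM (G i x) +
        partialDeriv i η x * Complex.imCLM (v x) : ℝ) : ℂ) := by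
    intro i
    rw [← integral_const_mul, ← integral_sub (hIG _ i) ((hIG _ i).const_mul _)]
    refine integral_congr_ae (.of_forall fun x => ?_)
    simp only [hconj, Complex.reCLM_apply, Complex.imCLM_apply]
    push_cast
    ring
  have hV : ∫ x in D, η x * (v x * starRingEnd ℂ (v x)) =
      (∫ x in D, v x * ((η x * Complex.reCLM (v x) : ℝ) : ℂ)) - Complex.I *
      ∫ x in D, v x * ((η x * Complex.imCLM (v x) : ℝ) : ℂ) := by
    rw [← integral_const_mul, ← integral_sub (hIv _) ((hIv _).const_mul _)]
    refine integral_congr_ae (.of_forall fun x => ?_)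
    simp only [hconj, Complex.reCLM_apply, Complex.imCLM_apply]
    push_cast
    ring
  rw [energyDefect, integral_sub (integrable_finsetSum _ fun i _ =>
    integrable_energyDefect_gradient hv hη i) ((integrable_energyDefect_mass hv hη).const_mul _),
    integral_finsetSum _ fun i _ => integrable_energyDefect_gradient hv hη i, integral_const_mul]
  simp_rw [hG]
  rw [hV, Finset.sum_sub_distrib, ← Finset.mul_sum, hre, him]
  ring

end LocalEnergy

/-! ### Local Green identities and their patching. -/

section Locality

variable {D U : Set Plane} {k : ℂ} {v : Plane → ℂ} {G : Fin 2 → Plane → ℂ}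

/-- Near a boundary point where the trace vanishes, Green's identity holds. -/
theorem exists_energyDefect_eq_zero_of_graph {e : Plane ≃ₗᵢ[ℝ] Plane} {ζ : ℝ → ℝ} {K : NNReal}
    {x₀ : Plane} {r : ℝ} (hr : 0 < r) (hζ : LipschitzWith K ζ)
    (hgraph : ∀ y ∈ Metric.ball x₀ r, (y ∈ D ↔ ζ (e y 0) < e y 1))
    (hDb : Bornology.IsBounded D) (hDo : IsOpen D) (hv : IsH1WithGradient D v G)
    (hsol : ∀ ψ, IsTestFunction D ψ →
      ∑ i, ∫ x in D, G i x * ((partialDeriv i ψ x : ℝ) : ℂ) = k ^ 2 * ∫ x in D, v x * (ψ x : ℂ))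
    (hibp : ∀ i Φ, IsTestFunction (Metric.ball x₀ r) Φ →
      ∫ x in D, v x * ((partialDeriv i Φ x : ℝ) : ℂ) = -∫ x in D, G i x * (Φ x : ℂ)) :
    ∃ s > 0, ∀ η, IsTestFunction (Metric.ball x₀ s) η → energyDefect k D v G η = 0 := by
  refine ⟨r / 2, by positivity, fun η hη => ?_⟩
  -- The open cone steeper than the graph: adding such a `y` to a point on or above the graph lands
  -- strictly above it. Half of `r` is kept so that the moved point stays in the ball where the
  -- graph description holds.
  set Y : Set Plane := {y | ‖y‖ < r / 2 ∧ K * |e y 0| < e y 1}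
  have hY : IsOpen Y := (isOpen_lt continuous_norm continuous_const).inter
    (isOpen_lt (f := fun y : Plane => K * |e y 0|) (g := fun y : Plane => e y 1)
      (by fun_prop) (by fun_prop))
  have hY0 : (0 : Plane) ∈ closure Y := by
    have hc : Continuous fun s : ℝ => chart e (0, s) := (chart e).continuous.comp (by fun_prop)
    have hlim : Tendsto (fun s : ℝ => chart e (0, s)) (𝓝[>] 0) (𝓝 0) := by
      have := hc.tendsto 0
      rw [show chart e (0, (0 : ℝ)) = 0 from map_zero _] at this
      exact this.mono_left nhdsWithin_le_nhds
    refine mem_closure_of_tendsto hlim ?_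
    have h1 : ∀ᶠ s in 𝓝[>] (0 : ℝ), ‖chart e (0, s)‖ < r / 2 := by
      have := hlim.norm
      rw [norm_zero] at this
      exact this.eventually (gt_mem_nhds (by positivity))
    filter_upwards [h1, self_mem_nhdsWithin] with s hs h0
    exact ⟨hs, by simpa using h0⟩
  refine energyDefect_eq_zero_of_translate hDb hDo hv hsol hibp
    (hη.mono (Metric.ball_subset_ball (by linarith))) hY hY0 ?_
  rintro x ⟨hxD, hxη⟩ y ⟨hy1, hy2⟩
  have hxb : dist x x₀ < r / 2 := hη.3 hxη
  have hxr : x ∈ Metric.ball x₀ r := Metric.ball_subset_ball (by linarith) hxb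
  have hxg : ζ (e x 0) ≤ e x 1 := by
    have hx' : x ∈ closure (Metric.ball x₀ r ∩ D) :=
      Metric.isOpen_ball.inter_closure ⟨hxr, hxD⟩
    have hcl : IsClosed {z : Plane | ζ (e z 0) ≤ e z 1} :=
      isClosed_le (hζ.continuous.comp (by fun_prop)) (by fun_prop)
    exact closure_minimal (fun z hz => ((hgraph z hz.1).1 hz.2).le) hcl hx'
  rw [hgraph]
  · have h1 := hζ.dist_le_mul (e (x + y) 0) (e x 0)
    rw [Real.dist_eq, Real.dist_eq] at h1
    simp only [map_add, PiLp.add_apply, add_sub_cancel_left] at h1 ⊢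
    have h2 := (abs_le.1 h1).2
    linarith
  · rw [dist_eq_norm] at hxb
    rw [Metric.mem_ball, dist_eq_norm]
    calc ‖x + y - x₀‖ = ‖(x - x₀) + y‖ := by congr 1; abel
      _ ≤ ‖x - x₀‖ + ‖y‖ := norm_add_le _ _
      _ < r := by linarith

theorem exists_energyDefect_eq_zero_of_mem {x₀ : Plane} (hx₀ : x₀ ∈ D)
    (hDb : Bornology.IsBounded D) (hDo : IsOpen D) (hv : IsH1WithGradient D v G)
    (hsol : ∀ ψ, IsTestFunction D ψ →
      ∑ i, ∫ x in D, G i x * ((partialDeriv i ψ x : ℝ) : ℂ) = k ^ 2 * ∫ x in D, v x * (ψ x : ℂ)) :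
    ∃ s > 0, ∀ η, IsTestFunction (Metric.ball x₀ s) η → energyDefect k D v G η = 0 := by
  obtain ⟨r, hr, hball⟩ := Metric.isOpen_iff.1 hDo x₀ hx₀
  refine ⟨r / 2, by positivity, fun η hη => ?_⟩
  refine energyDefect_eq_zero_of_translate hDb hDo hv hsol (U := D) hv.integral_eq
    (hη.mono ((Metric.ball_subset_ball (by linarith)).trans hball)) (Y := Metric.ball 0 (r / 2))
    Metric.isOpen_ball (subset_closure (Metric.mem_ball_self (by positivity))) ?_
  rintro x ⟨-, hxη⟩ y hy
  have hxb := hη.3 hxη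
  refine hball ?_
  rw [Metric.mem_ball, dist_eq_norm] at hxb ⊢
  rw [mem_ball_zero_iff] at hy
  calc ‖x + y - x₀‖ = ‖(x - x₀) + y‖ := by congr 1; abel
    _ ≤ ‖x - x₀‖ + ‖y‖ := norm_add_le _ _
    _ < r := by linarith

theorem exists_energyDefect_eq_zero_of_notMem_closure {x₀ : Plane}
    (hx₀ : x₀ ∉ closure D) :
    ∃ s > 0, ∀ η, IsTestFunction (Metric.ball x₀ s) η → energyDefect k D v G η = 0 := by
  obtain ⟨r, hr, hball⟩ := Metric.isOpen_iff.1 isClosed_closure.isOpen_compl x₀ hx₀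
  refine ⟨r, hr, fun η hη => ?_⟩
  refine setIntegral_eq_zero_of_forall_eq_zero fun x hx => ?_
  have hz : x ∉ Metric.ball x₀ r := fun h => hball h (subset_closure hx)
  have h1 : η x = 0 := image_eq_zero_of_notMem_tsupport fun h => hz (hη.3 h)
  have h2 : ∀ i, partialDeriv i η x = 0 := fun i =>
    image_eq_zero_of_notMem_tsupport fun h => hz ((hη.partialDeriv i).3 h)
  simp [h1, h2]

theorem energyDefect_sum (hv : IsH1WithGradient D v G) {ι : Type*} (s : Finset ι)
    {η : ι → Plane → ℝ} (hη : ∀ j ∈ s, IsTestFunction U (η j)) :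
    energyDefect k D v G (fun x => ∑ j ∈ s, η j x) = ∑ j ∈ s, energyDefect k D v G (η j) := by
  simp only [energyDefect]
  rw [← integral_finsetSum _ fun j hj => integrable_energyDefect hv (hη j hj)]
  refine integral_congr_ae (.of_forall fun x => ?_)
  have hd : ∀ i, partialDeriv i (fun x => ∑ j ∈ s, η j x) x = ∑ j ∈ s, partialDeriv i (η j) x := by
    intro i
    simp only [partialDeriv]
    rw [fderiv_fun_sum fun j hj => (hη j hj).differentiable x]
    simp
  simp only [hd]
  push_cast
  simp only [Finset.sum_sub_distrib, Finset.sum_add_distrib, mul_add, Finset.mul_sum,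
    Finset.sum_mul, Fin.sum_univ_two]

open scoped Manifold in
/-- A test function is a finite sum of test functions with small supports. -/
theorem IsTestFunction.exists_sum {η : Plane → ℝ} (hη : IsTestFunction U η) {r : Plane → ℝ}
    (hr : ∀ x ∈ U, 0 < r x) :
    ∃ (s : Finset (tsupport η)) (θ : tsupport η → Plane → ℝ),
      (∀ j ∈ s, IsTestFunction U (θ j) ∧ IsTestFunction (Metric.ball (j : Plane) (r j)) (θ j)) ∧
      η = fun x => ∑ j ∈ s, θ j x := by
  obtain ⟨f, hf⟩ := SmoothPartitionOfUnity.exists_isSubordinate 𝓘(ℝ, Plane) (s := tsupport η)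
    (isClosed_tsupport η) (fun x : tsupport η => Metric.ball (x : Plane) (r x))
    (fun _ => Metric.isOpen_ball)
    (fun x hx => mem_iUnion.2 ⟨⟨x, hx⟩, Metric.mem_ball_self (hr x (hη.3 hx))⟩)
  have hfin := f.locallyFinite.finite_nonempty_inter_compact hη.2
  have hsmooth : ∀ j, ContDiff ℝ ∞ (f j) := fun j => (f j).contMDiff.contDiff
  refine ⟨hfin.toFinset, fun j x => f j x * η x, fun j _ => ⟨hη.mul_left (hsmooth j), ?_⟩, ?_⟩
  · refine ⟨(hsmooth j).mul hη.1, hη.2.mul_left, ?_⟩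
    exact (closure_mono (Function.support_mul_subset_left _ _)).trans (hf j)
  · ext x
    rw [← Finset.sum_mul]
    by_cases hx : x ∈ tsupport η
    · have h1 := f.sum_eq_one hx
      rw [finsum_eq_sum_of_support_subset _ (s := hfin.toFinset)] at h1
      · rw [h1, one_mul]
      · intro j hj
        simp only [Finite.coe_toFinset, mem_ofPred_eq]
        exact ⟨x, hj, hx⟩
    · rw [image_eq_zero_of_notMem_tsupport hx, mul_zero]

theorem energyDefect_eq_zero_of_local (hv : IsH1WithGradient D v G)
    (hloc : ∀ x₀ ∈ U, ∃ s > 0, ∀ η, IsTestFunction (Metric.ball x₀ s) η →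
      energyDefect k D v G η = 0)
    {η : Plane → ℝ} (hη : IsTestFunction U η) : energyDefect k D v G η = 0 := by
  choose! r hr hzero using hloc
  obtain ⟨s, θ, hθ, hsum⟩ := hη.exists_sum hr
  rw [hsum, energyDefect_sum hv s fun j hj => (hθ j hj).1]
  exact Finset.sum_eq_zero fun j hj => hzero j (hη.3 j.2) _ (hθ j hj).2

end Locality

/-! ### Green's identity on the truncated domain. -/

section Truncation

variable {P : Set Plane} {k : ℂ} {v : Plane → ℂ} {R : ℝ}

theorem truncation_subset (P : Set Plane) (R : ℝ) : truncation P R ⊆ P := fun _ hx => hx.1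

theorem frontier_truncation_inter_ball_subset (P : Set Plane) (R : ℝ) :
    frontier (truncation P R) ∩ Metric.ball 0 (R + 1) ⊆ frontier P ∩ {x | ‖x‖ < R + 1} := by
  have h : truncation P R ∩ Metric.ball 0 (R + 1) = P ∩ Metric.ball 0 (R + 1) := by
    ext x
    simp [truncation]
  rintro x ⟨hx, hxb⟩
  have h1 := (frontier_inter_open_inter (s := truncation P R)
    (Metric.isOpen_ball (x := (0 : Plane)) (ε := R + 1)))
  have h2 := (frontier_inter_open_inter (s := P)
    (Metric.isOpen_ball (x := (0 : Plane)) (ε := R + 1)))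
  have h3 : x ∈ frontier P ∩ Metric.ball 0 (R + 1) := by
    rw [← h2, ← h, h1]
    exact ⟨hx, hxb⟩
  exact ⟨h3.1, by simpa using hxb⟩

/-- Green's identity on the truncated domain, for test functions that need not vanish near the
boundary of the untruncated domain. -/
theorem exists_gradient_energyDefect_eq_zero (hP : IsOpen P)
    (hlip : IsLipschitzDomain (truncation P R)) (hsol : SolvesHelmholtz k P v) {g : Plane → ℂ}
    (htr : HasTrace (truncation P R) v g)
    (hg : ∀ᵐ x ∂((μH[1] : Measure Plane).restrict (frontier P ∩ {x | ‖x‖ < R + 1})), g x = 0) :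
    ∃ G, IsH1WithGradient (truncation P R) v G ∧
      ∀ η, IsTestFunction (Metric.ball 0 (R + 1)) η →
        energyDefect k (truncation P R) v G η = 0 := by
  obtain ⟨-, G, hv, φ, hφ, hφv, hφG, hφg⟩ := htr
  refine ⟨G, hv, fun η hη => energyDefect_eq_zero_of_local hv (fun x₀ hx₀ => ?_) hη⟩
  have hsol' := fun ψ hψ =>
    hsol.sum_integral_gradient_mul hP.measurableSet (truncation_subset P R) hv (ψ := ψ) hψ
  by_cases hxD : x₀ ∈ truncation P R
  · exact exists_energyDefect_eq_zero_of_mem hxD hlip.isBounded hlip.isOpen hv hsol'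
  by_cases hxc : x₀ ∈ closure (truncation P R)
  swap
  · exact exists_energyDefect_eq_zero_of_notMem_closure hxc
  have hxf : x₀ ∈ frontier (truncation P R) := by
    rw [hlip.isOpen.frontier_eq]
    exact ⟨hxc, hxD⟩
  obtain ⟨e, ζ, ⟨K, hζ⟩, r₁, hr₁, hgraph⟩ := hlip.exists_graph x₀ hxf
  obtain ⟨r₂, hr₂, hball⟩ := Metric.isOpen_iff.1 Metric.isOpen_ball x₀ hx₀
  -- The radius `r₂` keeps the ball away from the circle `‖x‖ = R + 1`, where the trace is not known
  -- to vanish.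
  have hgraph' : ∀ y ∈ Metric.ball x₀ (min r₁ r₂),
      (y ∈ truncation P R ↔ ζ (e y 0) < e y 1) := fun y hy =>
    hgraph y (Metric.ball_subset_ball (min_le_left _ _) hy)
  have hsub : frontier (truncation P R) ∩ Metric.ball x₀ (min r₁ r₂) ⊆
      frontier P ∩ {x | ‖x‖ < R + 1} :=
    (inter_subset_inter_right _ ((Metric.ball_subset_ball (min_le_right _ _)).trans hball)).trans
      (frontier_truncation_inter_ball_subset P R)
  refine exists_energyDefect_eq_zero_of_graph (lt_min hr₁ hr₂) hζ hgraph' hlip.isBounded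
    hlip.isOpen hv hsol' fun i Φ hΦ => ?_
  exact setIntegral_mul_partialDeriv_of_zero_trace hlip.isOpen hζ hgraph' hv hφ hφv hφG hφg
    (ae_mono (Measure.restrict_mono hsub le_rfl) hg) i hΦ

end Truncation

/-! ### Uniqueness and gluing of weak gradients. -/

section Gluing

variable {D E P : Set Plane} {v : Plane → ℂ} {G H : Fin 2 → Plane → ℂ}

theorem IsH1WithGradient.mono (h : IsH1WithGradient D v G) (hD : IsOpen D) (hED : E ⊆ D) :
    IsH1WithGradient E v G := by
  refine ⟨h.1.mono_measure (Measure.restrict_mono hED le_rfl),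
    fun i => (h.2 i).mono_measure (Measure.restrict_mono hED le_rfl), fun i φ hφ => ?_⟩
  have h0 := h.3 i φ (hφ.mono hED)
  rwa [setIntegral_eq_of_subset_of_forall_sdiff_eq_zero hD.measurableSet hED,
    setIntegral_eq_of_subset_of_forall_sdiff_eq_zero hD.measurableSet hED] at h0
  · intro x hx
    rw [image_eq_zero_of_notMem_tsupport fun h => hx.2 (hφ.3 h)]
    simp
  · intro x hx
    rw [image_eq_zero_of_notMem_tsupport fun h => hx.2 ((hφ.partialDeriv i).3 h)]
    simp

theorem IsH1WithGradient.gradient_ae_eq (h : IsH1WithGradient D v G) (h' : IsH1WithGradient D v H)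
    (hD : IsOpen D) (i : Fin 2) : ∀ᵐ x, x ∈ D → G i x = H i x := by
  have hm : MemLp (fun x => G i x - H i x) 2 (volume.restrict D) := (h.2 i).sub (h'.2 i)
  have := hD.ae_eq_zero_of_integral_contDiff_smul_eq_zero (μ := volume)
    (f := fun x => G i x - H i x)
    (locallyIntegrableOn_of_locallyIntegrable_restrict (hm.locallyIntegrable (by norm_num)))
    fun φ h1 h2 h3 => ?_
  · filter_upwards [this] with x hx hxD
    exact sub_eq_zero.1 (hx hxD)
  · have hφ : IsTestFunction D φ := ⟨h1, h2, h3⟩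
    have e1 := h.3 i φ hφ
    have e2 := h'.3 i φ hφ
    rw [← setIntegral_eq_integral_of_forall_compl_eq_zero (s := D)]
    · have hI : ∫ x in D, φ x • (G i x - H i x) =
          (∫ x in D, G i x * (φ x : ℂ)) - ∫ x in D, H i x * (φ x : ℂ) := by
        rw [← integral_sub]
        · refine integral_congr_ae (.of_forall fun x => ?_)
          simp only [Complex.real_smul]
          ring
        · exact (h.2 i).integrable_mul (hφ.ofReal_memLp 2)
        · exact (h'.2 i).integrable_mul (hφ.ofReal_memLp 2)
      rw [hI]
      linear_combination -(e1.symm.trans e2)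
    · intro x hx
      rw [image_eq_zero_of_notMem_tsupport fun h => hx (hφ.3 h), zero_smul]

/-- Weak gradients on an increasing exhaustion which are bounded in `L²` give a global one. -/
theorem memH1_iUnion {D : ℕ → Set Plane} (hmono : Monotone D) (hD : ∀ n, IsOpen (D n))
    (hv : MemLp v 2 (volume.restrict (⋃ n, D n))) {G : ℕ → Fin 2 → Plane → ℂ}
    (hG : ∀ n, IsH1WithGradient (D n) v (G n)) {M : ℝ≥0∞} (hM : M ≠ ⊤)
    (hbound : ∀ n i, ∫⁻ x in D n, ‖G n i x‖ₑ ^ (2 : ℝ) ≤ M) : MemH1 (⋃ n, D n) v := by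
  classical
  -- The glued gradient uses, at each point, the first set of the exhaustion containing it;
  -- uniqueness makes this agree a.e. with every `G n` on `D n`.
  let idx : Plane → ℕ := fun x => if h : ∃ n, x ∈ D n then Nat.find h else 0
  have hidx : ∀ n, ∀ x ∈ D n, idx x ≤ n ∧ x ∈ D (idx x) := by
    intro n x hx
    have h : ∃ n, x ∈ D n := ⟨n, hx⟩
    simp only [idx, dif_pos h]
    exact ⟨Nat.find_min' h hx, Nat.find_spec h⟩
  set F : Fin 2 → Plane → ℂ := fun i x => G (idx x) i x
  have hF : ∀ n i, F i =ᵐ[volume.restrict (D n)] G n i := by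
    intro n i
    rw [Filter.EventuallyEq, ae_restrict_iff' (hD n).measurableSet]
    have h : ∀ m, ∀ᵐ x, m ≤ n → x ∈ D m → G m i x = G n i x := by
      intro m
      by_cases hmn : m ≤ n
      · filter_upwards [(hG m).gradient_ae_eq ((hG n).mono (hD n) (hmono hmn)) (hD m) i] with x hx
        exact fun _ => hx
      · exact .of_forall fun x h => absurd h hmn
    filter_upwards [ae_all_iff.2 h] with x hx hxn
    exact hx _ (hidx n x hxn).1 (hidx n x hxn).2
  refine ⟨F, hv, fun i => ⟨?_, ?_⟩, fun i φ hφ => ?_⟩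
  · rw [aestronglyMeasurable_iUnion_iff]
    exact fun n => ((hG n).2 i).1.congr (hF n i).symm
  · rw [eLpNorm_lt_top_iff_lintegral_rpow_enorm_lt_top (by norm_num) (by norm_num)]
    refine lt_of_le_of_lt ?_ hM.lt_top
    rw [setLIntegral_iUnion_of_directed _ (directed_of_isDirected_le hmono)]
    refine iSup_le fun n => ?_
    rw [ENNReal.toReal_ofNat]
    refine le_trans (le_of_eq (lintegral_congr_ae ?_)) (hbound n i)
    filter_upwards [hF n i] with x hx
    rw [hx]
  · obtain ⟨n, hn⟩ := hφ.2.elim_directed_cover D hD hφ.3 (directed_of_isDirected_le hmono)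
    have hφn : IsTestFunction (D n) φ := ⟨hφ.1, hφ.2, hn⟩
    have h0 := (hG n).3 i φ hφn
    have hU : MeasurableSet (⋃ n, D n) := (isOpen_iUnion hD).measurableSet
    rw [setIntegral_eq_of_subset_of_forall_sdiff_eq_zero hU (subset_iUnion D n),
      setIntegral_eq_of_subset_of_forall_sdiff_eq_zero hU (subset_iUnion D n), h0]
    · congr 1
      refine integral_congr_ae ?_
      filter_upwards [hF n i] with x hx
      rw [hx]
    · intro x hx
      rw [image_eq_zero_of_notMem_tsupport fun h => hx.2 (hφn.3 h)]
      simp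
    · intro x hx
      rw [image_eq_zero_of_notMem_tsupport fun h => hx.2 ((hφn.partialDeriv i).3 h)]
      simp

end Gluing

/-! ### Caccioppoli inequality and cutoffs. -/

section Caccioppoli

variable {D U : Set Plane} {k : ℂ} {v : Plane → ℂ} {G : Fin 2 → Plane → ℂ} {χ : Plane → ℝ}

theorem integrable_testFunction_mul_normSq {f : Plane → ℂ} {μ : Measure Plane}
    [IsFiniteMeasureOnCompacts μ] (hχ : IsTestFunction U χ) (hf : MemLp f 2 μ) :
    Integrable (fun x => χ x ^ 2 * ‖f x‖ ^ 2) μ := by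
  have := (memLp_testFunction_mul hχ hf).integrable_norm_pow (p := 2) (by norm_num)
  refine this.congr (.of_forall fun x => ?_)
  simp [mul_pow]

/-- The Caccioppoli inequality. -/
theorem sum_integral_sq_mul_gradient_le (hv : IsH1WithGradient D v G) (hχ : IsTestFunction U χ)
    (hχ1 : ∀ x, |χ x| ≤ 1) {C : ℝ} (hC : ∀ i x, |partialDeriv i χ x| ≤ C)
    (hdef : energyDefect k D v G (fun x => χ x * χ x) = 0) :
    ∑ i, ∫ x in D, χ x ^ 2 * ‖G i x‖ ^ 2 ≤ 2 * (4 * C ^ 2 + ‖k ^ 2‖) * ∫ x in D, ‖v x‖ ^ 2 := by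
  have hη : IsTestFunction U (fun x => χ x * χ x) := hχ.mul_left hχ.1
  have hI := integrable_energyDefect (k := k) hv hη
  have h0 : (∫ x in D, ((∑ i, G i x * ((χ x * χ x : ℝ) * starRingEnd ℂ (G i x) +
      (partialDeriv i (fun x => χ x * χ x) x : ℝ) * starRingEnd ℂ (v x))) -
        k ^ 2 * ((χ x * χ x : ℝ) * (v x * starRingEnd ℂ (v x)))).re) = 0 := by
    have := congrArg Complex.re hdef
    rw [energyDefect] at this
    have h2 := Complex.reCLM.integral_comp_comm hI
    simp only [Complex.reCLM_apply] at h2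
    rw [h2, this, Complex.zero_re]
  have hIv : Integrable (fun x => ‖v x‖ ^ 2) (volume.restrict D) :=
    hv.memLp.integrable_norm_pow (p := 2) (by norm_num)
  have hIG := fun i => integrable_testFunction_mul_normSq hχ (hv.memLp_gradient i)
  have hmono : ∫ x in D, ((1 / 2) * (∑ i, χ x ^ 2 * ‖G i x‖ ^ 2) -
      (4 * C ^ 2 + ‖k ^ 2‖) * ‖v x‖ ^ 2) ≤ 0 := by
    rw [← h0]
    refine integral_mono (((integrable_finsetSum _ fun i _ => hIG i).const_mul _).sub
      (hIv.const_mul _)) (Complex.reCLM.integrable_comp hI) fun x => ?_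
    -- Young's inequality `2ab ≤ a²/2 + 2b²` with `a = |χ||Gᵢ|` and `b = |∂ᵢχ||v|`. The two
    -- directions together cost `4 C²`.
    have hterm : ∀ i, (1 / 2) * (χ x ^ 2 * ‖G i x‖ ^ 2) - 2 * C ^ 2 * ‖v x‖ ^ 2 ≤
        (G i x * ((χ x * χ x : ℝ) * starRingEnd ℂ (G i x) +
          (partialDeriv i (fun x => χ x * χ x) x : ℝ) * starRingEnd ℂ (v x))).re := by
      intro i
      have he : (G i x * ((χ x * χ x : ℝ) * starRingEnd ℂ (G i x) +
          (partialDeriv i (fun x => χ x * χ x) x : ℝ) * starRingEnd ℂ (v x))).re =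
          χ x ^ 2 * ‖G i x‖ ^ 2 +
            2 * χ x * partialDeriv i χ x * (G i x * starRingEnd ℂ (v x)).re := by
        rw [partialDeriv_mul i hχ.differentiable hχ.differentiable, Complex.sq_norm,
          Complex.normSq_apply]
        simp only [Complex.mul_re, Complex.add_re, Complex.add_im, Complex.mul_im,
          Complex.ofReal_re, Complex.ofReal_im, Complex.conj_re, Complex.conj_im]
        ring
      have hb : |(G i x * starRingEnd ℂ (v x)).re| ≤ ‖G i x‖ * ‖v x‖ := by
        simpa using Complex.abs_re_le_norm (G i x * starRingEnd ℂ (v x))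
      have hp : (partialDeriv i χ x) ^ 2 ≤ C ^ 2 := sq_le_sq' (neg_le_of_abs_le (hC i x))
        (le_of_abs_le (hC i x))
      have hq : |2 * χ x * partialDeriv i χ x * (G i x * starRingEnd ℂ (v x)).re| ≤
          2 * (|χ x| * ‖G i x‖) * (|partialDeriv i χ x| * ‖v x‖) := by
        rw [abs_mul, abs_mul, abs_mul, abs_two]
        calc _ ≤ 2 * |χ x| * |partialDeriv i χ x| * (‖G i x‖ * ‖v x‖) := by gcongr
          _ = _ := by ring
      have hy := sq_nonneg (|χ x| * ‖G i x‖ - 2 * (|partialDeriv i χ x| * ‖v x‖))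
      have hl := neg_le_of_abs_le hq
      have h3 : partialDeriv i χ x ^ 2 * ‖v x‖ ^ 2 ≤ C ^ 2 * ‖v x‖ ^ 2 := by gcongr
      have h4 : (|χ x| * ‖G i x‖ - 2 * (|partialDeriv i χ x| * ‖v x‖)) ^ 2 =
          χ x ^ 2 * ‖G i x‖ ^ 2 - 2 * (2 * (|χ x| * ‖G i x‖) * (|partialDeriv i χ x| * ‖v x‖))
            + 4 * (partialDeriv i χ x ^ 2 * ‖v x‖ ^ 2) := by
        rw [← sq_abs (χ x), ← sq_abs (partialDeriv i χ x)]
        ring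
      rw [he]
      linarith
    have hk : (k ^ 2 * ((χ x * χ x : ℝ) * (v x * starRingEnd ℂ (v x)))).re ≤
        ‖k ^ 2‖ * ‖v x‖ ^ 2 := by
      refine (Complex.re_le_norm _).trans ?_
      rw [norm_mul, norm_mul, norm_mul, RCLike.norm_conj, Complex.norm_real, Real.norm_eq_abs,
        abs_mul, ← sq ‖v x‖]
      have : |χ x| * |χ x| ≤ 1 := mul_le_one₀ (hχ1 x) (abs_nonneg _) (hχ1 x)
      refine mul_le_mul_of_nonneg_left ?_ (norm_nonneg _)
      exact mul_le_of_le_one_left (by positivity) this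
    have h5 := hterm 0
    have h6 := hterm 1
    simp only [Fin.sum_univ_two, Complex.sub_re, Complex.add_re (G 0 x * _)] at *
    linarith
  rw [integral_sub ((integrable_finsetSum _ fun i _ => hIG i).const_mul _) (hIv.const_mul _),
    integral_const_mul, integral_const_mul, integral_finsetSum _ fun i _ => hIG i] at hmono
  linarith

/-- Cutoff functions with uniformly bounded derivatives. -/
theorem exists_cutoff : ∃ C : ℝ, ∀ ρ : ℝ, 1 ≤ ρ → ∀ S, 2 * ρ < S → ∃ χ : Plane → ℝ,
    IsTestFunction (Metric.ball 0 S) χ ∧ (∀ x, |χ x| ≤ 1) ∧ (∀ i x, |partialDeriv i χ x| ≤ C) ∧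
      ∀ x ∈ Metric.ball 0 ρ, χ x = 1 := by
  -- A single bump is dilated by `ρ`; its derivative is multiplied by `ρ⁻¹ ≤ 1`, so one `C` serves
  -- all `ρ`.
  let b : ContDiffBump (0 : Plane) := ⟨1, 2, one_pos, one_lt_two⟩
  have hb : ContDiff ℝ ∞ b := b.contDiff
  obtain ⟨C, hC⟩ := (b.hasCompactSupport.fderiv (𝕜 := ℝ)).exists_bound_of_continuous
    (hb.continuous_fderiv (by simp))
  have hC0 : 0 ≤ C := (norm_nonneg _).trans (hC 0)
  refine ⟨C, fun ρ hρ S hS => ⟨fun x => b (ρ⁻¹ • x), ⟨?_, ?_, ?_⟩, fun x => ?_, fun i x => ?_,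
    fun x hx => ?_⟩⟩
  · exact hb.comp (contDiff_const_smul _)
  · exact b.hasCompactSupport.comp_smul (by positivity)
  · have hsub : tsupport (fun x => b (ρ⁻¹ • x)) ⊆ Metric.closedBall 0 (2 * ρ) := by
      refine closure_minimal (fun x hx => ?_) Metric.isClosed_closedBall
      have : ρ⁻¹ • x ∈ Function.support b := hx
      rw [b.support_eq, mem_ball_zero_iff, norm_smul, Real.norm_eq_abs, abs_inv,
        abs_of_pos (by linarith), inv_mul_lt_iff₀ (by linarith)] at this
      rw [mem_closedBall_zero_iff]
      linarith
    exact hsub.trans (Metric.closedBall_subset_ball hS)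
  · rw [abs_of_nonneg b.nonneg]
    exact b.le_one
  · have hd : HasFDerivAt (fun x => b (ρ⁻¹ • x)) _ x :=
      ((hb.differentiable (by simp)) (ρ⁻¹ • x)).hasFDerivAt.comp x
        ((hasFDerivAt_id x).const_smul ρ⁻¹)
    rw [partialDeriv, hd.fderiv]
    have h1 := (fderiv ℝ b (ρ⁻¹ • x)).le_opNorm (ρ⁻¹ • EuclideanSpace.single i (1 : ℝ))
    have h2 : ‖ρ⁻¹ • (EuclideanSpace.single i (1 : ℝ) : Plane)‖ ≤ 1 := by
      rw [norm_smul, PiLp.norm_single, norm_one, mul_one, Real.norm_eq_abs, abs_inv,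
        abs_of_pos (by linarith)]
      exact inv_le_one_of_one_le₀ hρ
    simp only [ContinuousLinearMap.comp_apply, _root_.smul_apply,
      ContinuousLinearMap.id_apply]
    calc _ ≤ C * 1 := h1.trans (mul_le_mul (hC _) h2 (norm_nonneg _) hC0)
      _ = C := mul_one C
  · refine b.one_of_mem_closedBall ?_
    rw [mem_ball_zero_iff] at hx
    rw [mem_closedBall_zero_iff, norm_smul, Real.norm_eq_abs, abs_inv, abs_of_pos (by linarith),
      inv_mul_le_iff₀ (by linarith)]
    change ‖x‖ ≤ ρ * 1
    linarith

theorem lintegral_gradient_inter_ball_le (hDo : IsOpen D) (hv : IsH1WithGradient D v G)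
    (hχ : IsTestFunction U χ) {ρ M : ℝ} (hχ1 : ∀ x ∈ Metric.ball 0 ρ, χ x = 1)
    (hM : ∑ i, ∫ x in D, χ x ^ 2 * ‖G i x‖ ^ 2 ≤ M) (i : Fin 2) :
    ∫⁻ x in D ∩ Metric.ball 0 ρ, ‖G i x‖ₑ ^ (2 : ℝ) ≤ ENNReal.ofReal M := by
  have hIG := integrable_testFunction_mul_normSq hχ (hv.memLp_gradient i)
  calc _ = ∫⁻ x in D ∩ Metric.ball 0 ρ, ENNReal.ofReal (χ x ^ 2 * ‖G i x‖ ^ 2) := by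
        refine setLIntegral_congr_fun (hDo.inter Metric.isOpen_ball).measurableSet fun x hx => ?_
        simp only [hχ1 x hx.2, one_pow, one_mul]
        rw [ENNReal.ofReal_pow (norm_nonneg _), ofReal_norm, ENNReal.rpow_ofNat]
    _ ≤ ∫⁻ x in D, ENNReal.ofReal (χ x ^ 2 * ‖G i x‖ ^ 2) :=
        lintegral_mono_set inter_subset_left
    _ = ENNReal.ofReal (∫ x in D, χ x ^ 2 * ‖G i x‖ ^ 2) :=
        (ofReal_integral_eq_lintegral_ofReal hIG (.of_forall fun x => by positivity)).symm
    _ ≤ _ := by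
        refine ENNReal.ofReal_le_ofReal (le_trans ?_ hM)
        exact Finset.single_le_sum (f := fun i => ∫ x in D, χ x ^ 2 * ‖G i x‖ ^ 2)
          (fun j _ => integral_nonneg fun x => by positivity) (Finset.mem_univ i)

end Caccioppoli

end Helmholtz

/-! ### Conclusion by uniform bounds on an exhaustion. -/

theorem mainTheorem8 (k : ℂ) (P : Set Helmholtz.Plane) (hP : IsOpen P)
    (hP_unbounded : ¬ Bornology.IsBounded P)
    (hP_lipschitz : ∀ᶠ R : ℝ in atTop, Helmholtz.IsLipschitzDomain (Helmholtz.truncation P R))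
    (v : Helmholtz.Plane → ℂ) (hv : MemLp v 2 (volume.restrict P))
    (hv_loc : ∀ B : Set Helmholtz.Plane, IsOpen B → Bornology.IsBounded B → B ⊆ P →
      Helmholtz.MemH1 B v)
    (hv_helmholtz : Helmholtz.SolvesHelmholtz k P v)
    (hv_trace : Helmholtz.HasZeroTrace P v) :
    Helmholtz.MemH1 P v := by
  open Helmholtz in
  obtain ⟨C, hC⟩ := exists_cutoff
  -- The bound is independent of `n` because it involves the `L²` norm of `v` over all of `P`.
  set M : ℝ := 2 * (4 * C ^ 2 + ‖k ^ 2‖) * ∫ x in P, ‖v x‖ ^ 2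
  have hstep : ∀ n : ℕ, ∃ G, IsH1WithGradient (P ∩ Metric.ball 0 (n + 1 : ℝ)) v G ∧
      ∀ i, ∫⁻ x in P ∩ Metric.ball 0 (n + 1 : ℝ), ‖G i x‖ₑ ^ (2 : ℝ) ≤ ENNReal.ofReal M := by
    intro n
    -- With `R > 2(n + 1)`, a cutoff equal to 1 on the disk of radius `n + 1` has its support inside
    -- the disk of radius `R + 1`.
    obtain ⟨R, hlip, ⟨g, htr, hg⟩, hR⟩ :=
      (hP_lipschitz.and (hv_trace.and (eventually_gt_atTop (2 * (n + 1 : ℝ))))).exists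
    obtain ⟨G, hG, hdef⟩ := exists_gradient_energyDefect_eq_zero hP hlip hv_helmholtz htr hg
    obtain ⟨χ, hχ, hχle, hχd, hχ1⟩ := hC (n + 1) (by simp) (R + 1) (by linarith)
    have hn : (0 : ℝ) ≤ n := n.cast_nonneg
    have hset : P ∩ Metric.ball 0 (n + 1 : ℝ) =
        truncation P R ∩ Metric.ball 0 (n + 1 : ℝ) := by
      ext x
      simp only [truncation, mem_inter_iff, mem_ball_zero_iff, mem_ofPred_eq]
      exact ⟨fun h => ⟨⟨h.1, by linarith⟩, h.2⟩, fun h => ⟨h.1.1, h.2⟩⟩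
    rw [hset]
    refine ⟨G, hG.mono hlip.isOpen inter_subset_left, fun i =>
      lintegral_gradient_inter_ball_le hlip.isOpen hG hχ hχ1 ?_ i⟩
    refine (sum_integral_sq_mul_gradient_le hG hχ hχle hχd
      (hdef _ (hχ.mul_left hχ.1))).trans ?_
    refine mul_le_mul_of_nonneg_left ?_ (by positivity)
    exact setIntegral_mono_set (hv.integrable_norm_pow (p := 2) (by norm_num))
      (.of_forall fun x => by positivity) (truncation_subset P R).eventuallyLE
  choose G hG hbound using hstep
  have hunion : ⋃ n : ℕ, P ∩ Metric.ball 0 (n + 1 : ℝ) = P := by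
    rw [← inter_iUnion, inter_eq_left]
    intro x _
    obtain ⟨n, hn⟩ := exists_nat_gt ‖x‖
    exact mem_iUnion.2 ⟨n, by rw [mem_ball_zero_iff]; linarith⟩
  have hmono : Monotone fun n : ℕ => P ∩ Metric.ball 0 (n + 1 : ℝ) := fun m n hmn =>
    inter_subset_inter_right _ (Metric.ball_subset_ball (by gcongr))
  rw [← hunion] at hv ⊢
  exact memH1_iUnion hmono (fun n => hP.inter Metric.isOpen_ball) hv hG ENNReal.ofReal_ne_top
    hbound
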